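/- Let $q>1$ be real. For a function $h$ on the lattice $\{\sigma q^m:\sigma=\pm1,\ m\in\mathbb Z\}$ put $(Lh)(x)=h(q^{-1}x)$. Let $L^2_q$ be the Hilbert space of complex functions $\psi$ on this lattice with $(\psi,\psi)<\infty$, where $$(\chi,\psi)=\frac{q-q^{-1}}2\sum_{\sigma=\pm1}\sum_{\mu\in\mathbb Z}\sigma\,\big(L(x\chi^*\psi)\big)(\sigma q^\mu)=\frac{q-q^{-1}}2\sum_{\sigma=\pm1}\sum_{\mu\in\mathbb Z}q^{\mu-1}\chi^*(\sigma q^{\mu-1})\,\psi(\sigma q^{\mu-1}).$$ With $(a;b)_n=\prod_{i=0}^{n-1}(1-ab^i)$, let $$\cos_q z=\sum_{n\ge0}\frac{(-1)^nq^{-2n(n+1)}z^{2n}}{(q^{-2};q^{-2})_{2n}},\qquad \sin_q z=\sum_{n\ge0}\frac{(-1)^nq^{-2n(n+1)}z^{2n+1}}{(q^{-2};q^{-2})_{2n+1}},\qquad N_q=\frac{(q^{-2};q^{-4})_\infty}{(q^{-4};q^{-4})_\infty}.$$ (a) For $\sigma=\pm1$ and $\varepsilon\in\{0,1\}$ let $\mathcal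 H_\sigma^\varepsilon\subset L^2_q$ be the subspace belonging to the sign $\sigma$ and to the $\mu\equiv\varepsilon$ mod 2 ($\mu$ even for $\varepsilon=0$, $\mu$ odd for $\varepsilon=1$), i.e. the $\psi$ that vanish outside the points $\sigma q^{2k+\varepsilon-1}$, $k\in\mathbb Z$. Then $L^2_q$ is the orthogonal direct sum of these four subspaces, the orthogonal projector $\Pi_\sigma^\varepsilon$ onto $\mathcal H_\sigma^\varepsilon$ is multiplication by the indicator function of these points, and for $\psi\in\mathcal H_\sigma^\varepsilon$ $$(\psi,\psi)=\frac{q-q^{-1}}2\sum_{k\in\mathbb Z}\sigma\,\big(L(x\psi^*\psi)\big)(\sigma q^{2k+\varepsilon}).$$ (b) Put $\tilde N_q(m)=N_q\Big(\dfrac{2q^m}{q-q^{-1}}\Big)^{1/2}$, so that $\tilde N_q(2n+1)=N_q\Big(\dfrac{2q}{q-q^{-1}}\Big)^{1/2}q^n$ and $\tilde N_q(2n)=N_q\Big(\dfrac{2}{q-q^{-1}}\Big)^{1/2}q^n$. For each $\sigma=\pm1$, the functions $$\tilde N_q(2n+1)\cos_q(xq^{2n+1})\,\Pi_\sigma^{0}\quad(n\in\mathbb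 Z),\qquad\text{respectively}\qquad \tilde N_q(2n)\cos_q(xq^{2n})\,\Pi_\sigma^{1}\quad(n\in\mathbb Z),$$ form an orthonormal basis of $\mathcal H_\sigma^{0}$, respectively of $\mathcal H_\sigma^{1}$. The same holds with $\sin_q$ in place of $\cos_q$. For any choice of the $\cos_q$ or the $\sin_q$ basis in each of the four subspaces, the union of the chosen bases is an orthonormal basis of $L^2_q$. (c) There is a surjective linear isometry $f\mapsto g$ of $L^2_q$ onto itself that is its own inverse and such that for all $\sigma=\pm1$, $\varepsilon\in\{0,1\}$, $n,k\in\mathbb Z$, $$g(\sigma q^{-2n+\varepsilon})=N_q\sum_{k\in\mathbb Z}q^{-2k}\cos_q(q^{-2(k+n)})f(\sigma q^{-2k+\varepsilon}),\qquad f(\sigma q^{-2k+\varepsilon})=N_q\sum_{n\in\mathbb Z}q^{-2n}\cos_q(q^{-2(k+n)})g(\sigma q^{-2n+\varepsilon}),$$ $$\sum_{k\in\mathbb Z} q^{-2k+\varepsilon}|f(\sigma q^{-2k+\varepsilon})|^2=\sum_{n\in\mathbb Z} q^{-2n+\varepsilon}|g(\sigma q^{-2n+\varepsilon})|^2,$$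 with all series absolutely convergent. The same holds with $\sin_q$ in place of $\cos_q$. -/

import Mathlib

open MeasureTheory ComplexConjugate

noncomputable section

/-- The finite `q`-shifted factorial `(a; b)_n = ∏_{i < n} (1 - a b^i)`. -/
def qPoch (a b : ℝ) (n : ℕ) : ℝ := ∏ i ∈ Finset.range n, (1 - a * b ^ i)

/-- The infinite `q`-shifted factorial `(a; b)_∞ = ∏_{i ≥ 0} (1 - a b^i)`. -/
def qPochInf (a b : ℝ) : ℝ := ∏' i : ℕ, (1 - a * b ^ i)

/-- The `q`-cosine `∑ (-1)^n q^{-2n(n+1)} z^{2n} / (q^{-2}; q^{-2})_{2n}`; for `q > 1` the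
series converges absolutely for every `z`. -/
def cosq (q z : ℝ) : ℝ :=
  ∑' n : ℕ, (-1) ^ n * q ^ (-2 * (n : ℤ) * ((n : ℤ) + 1)) * z ^ (2 * n)
    / qPoch (q ^ (-2 : ℤ)) (q ^ (-2 : ℤ)) (2 * n)

/-- The `q`-sine `∑ (-1)^n q^{-2n(n+1)} z^{2n+1} / (q^{-2}; q^{-2})_{2n+1}`. -/
def sinq (q z : ℝ) : ℝ :=
  ∑' n : ℕ, (-1) ^ n * q ^ (-2 * (n : ℤ) * ((n : ℤ) + 1)) * z ^ (2 * n + 1)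
    / qPoch (q ^ (-2 : ℤ)) (q ^ (-2 : ℤ)) (2 * n + 1)

/-- The constant `N_q = (q^{-2}; q^{-4})_∞ / (q^{-4}; q^{-4})_∞`. -/
def Nq (q : ℝ) : ℝ :=
  qPochInf (q ^ (-2 : ℤ)) (q ^ (-4 : ℤ)) / qPochInf (q ^ (-4 : ℤ)) (q ^ (-4 : ℤ))

/-- The normalization constant of the basis function with index `m`,
`N_q (2 q^m / (q - q⁻¹))^{1/2}`. For `m = 2n+1` it is `N_q (2q / (q - q⁻¹))^{1/2} q^n`,
for `m = 2n` it is `N_q (2 / (q - q⁻¹))^{1/2} q^n`. -/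
def NqTilde (q : ℝ) (m : ℤ) : ℝ := Nq q * Real.sqrt (2 * q ^ m / (q - q⁻¹))

/-- The lattice point `σ q^m`, for a sign `σ = ±1` and `m ∈ ℤ`. -/
def latticePt (q : ℝ) (σ : ℤˣ) (m : ℤ) : ℝ := ((σ : ℤ) : ℝ) * q ^ m

/-- The dilatation `L` acting on fields: `(L h)(x) = h(q⁻¹ x)`, so that `L x^n = q^{-n} x^n`. -/
def dilate {E : Type*} (q : ℝ) (h : ℝ → E) (x : ℝ) : E := h (q⁻¹ * x)

/-- The measure of the `q`-integral
`∫ h = ½ (q - q⁻¹) ∑_{σ = ±1} ∑_μ σ ⟨μ,σ| L x h(x) |μ,σ⟩`.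
Since `x` has the eigenvalue `σ q^μ` on the state `|μ,σ⟩`, the matrix element is
`(L (x h))(σ q^μ) = σ q^{μ-1} h(σ q^{μ-1})`: the state `(μ, σ)` contributes a point mass
`½ (q - q⁻¹) q^{μ-1}` at `x = σ q^{μ-1}`. -/
def jackson (q : ℝ) : Measure ℝ :=
  Measure.sum fun p : ℤˣ × ℤ =>
    ENNReal.ofReal ((q - q⁻¹) / 2 * q ^ (p.2 - 1)) • Measure.dirac (latticePt q p.1 (p.2 - 1))

/-- The Hilbert space `L²_q`. -/
abbrev L2q (q : ℝ) : Type := Lp ℂ 2 (jackson q)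

/-- The points `x = σ q^{μ-1}` at which the states `(μ, σ)` with the given sign `σ` and with
`μ = 2k + ε`, `k ∈ ℤ`, evaluate a field. Even lattice labels `μ` are `ε = 0`, odd ones `ε = 1`. -/
def sectorPts (q : ℝ) (σ : ℤˣ) (ε : Fin 2) : Set ℝ :=
  {x | ∃ k : ℤ, x = latticePt q σ (2 * k + ((ε : ℕ) : ℤ) - 1)}

/-- The projector onto a sector, acting on fields: multiplication by the indicator function of the
points of the sector. -/
def sectorProj (q : ℝ) (σ : ℤˣ) (ε : Fin 2) (h : ℝ → ℂ) : ℝ → ℂ :=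
  (sectorPts q σ ε).indicator h

/-- The subspace of `L²_q` that belongs to the sign `σ` and the parity `ε` of `μ`. -/
def sector (q : ℝ) (σ : ℤˣ) (ε : Fin 2) : Submodule ℂ (L2q q) where
  carrier := {ψ | ∀ᵐ x ∂(jackson q), x ∉ sectorPts q σ ε → ψ x = 0}
  zero_mem' := by
    filter_upwards [Lp.coeFn_zero ℂ 2 (jackson q)] with x hx _
    simpa using hx
  add_mem' := by
    intro a b ha hb
    change ∀ᵐ x ∂(jackson q), x ∉ sectorPts q σ ε → (a + b : L2q q) x = 0
    change ∀ᵐ x ∂(jackson q), x ∉ sectorPts q σ ε → a x = 0 at ha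
    change ∀ᵐ x ∂(jackson q), x ∉ sectorPts q σ ε → b x = 0 at hb
    filter_upwards [Lp.coeFn_add a b, ha, hb] with x hx h1 h2 h3
    rw [hx, Pi.add_apply, h1 h3, h2 h3, add_zero]
  smul_mem' := by
    intro c a ha
    change ∀ᵐ x ∂(jackson q), x ∉ sectorPts q σ ε → (c • a : L2q q) x = 0
    change ∀ᵐ x ∂(jackson q), x ∉ sectorPts q σ ε → a x = 0 at ha
    filter_upwards [Lp.coeFn_smul c a, ha] with x hx h1 h3
    rw [hx, Pi.smul_apply, h1 h3, smul_zero]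

/-- The index `m` of the `n`-th basis function: `2n+1` if `μ` is even, `2n` if `μ` is odd. -/
def basisIdx (ε : Fin 2) (n : ℤ) : ℤ := 2 * n + 1 - ((ε : ℕ) : ℤ)

/-- For `T` the `q`-cosine or the `q`-sine, the function `Ñ_q T(x q^m)` times the projector onto
the sector `(σ, ε)`, where `m = 2n+1` or `m = 2n` according to the parity `ε`. -/
def basisFun (q : ℝ) (T : ℝ → ℝ) (σ : ℤˣ) (ε : Fin 2) (n : ℤ) : ℝ → ℂ :=
  sectorProj q σ ε fun x =>
    ((NqTilde q (basisIdx ε n) * T (x * q ^ basisIdx ε n) : ℝ) : ℂ)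

end

/-!
Write `p = q⁻²`, let `(a; p²)_∞` be the infinite shifted factorial and `e_n = 1 / (p²; p²)_n`
(zero for `n < 0`). Everything rests on one identity for the values of the `q`-cosine (`θ = 0`) and
the `q`-sine (`θ = 1`) at the points `p^j`, `j ∈ ℤ`:

`N_q T(p^j) = ∑_n α_n β_{n+j}`, `α_n = (-1)^n p^{n² + θ n} e_n`, `β_m = p^{θ m} e_m`

(`hasSum_correlation`). It follows by expanding `e_{n+j} = (p^{2(n+j+1)}; p²)_∞ / (p²; p²)_∞` with
Euler's formula `(a; p²)_∞ = ∑_l (-1)^l p^{l² - l} a^l e_l` (`hasSum_eulerTerm`), exchanging the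
sums, and using Euler's formula again.

By Euler's formula `α_n` and `β_m` are the coefficients of `(p^{θ+1} t; p²)_∞` and
`1 / (p^θ t; p²)_∞`. Hence the Laurent series `M(z) = ∑_j N_q T(p^j) z^j` is
`(p^{θ+1}/z; p²)_∞ / (p^θ z; p²)_∞`, and `M(z) M(p/z) = 1`. Comparing coefficients gives

`N_q² ∑_k p^k T(p^k) T(p^{k+d}) = δ_{d,0}`,

which is `hasSum_correlation_mul_correlation`; the proof stays with series and uses only the
coefficient identity `∑_n (-1)^n p^{n² - n} e_n e_{K-n} = δ_{K,0}` (`hasSum_invPoch_mul_invPoch`).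
In other words, the Hankel matrix with entries `N_q q^{n+k} T(q^{2(n+k)})` has orthonormal rows
(`hasSum_hankel_mul_hankel`).

Since this matrix is also symmetric, no separate completeness argument is needed: it acts on `ℓ²`
as an isometry whose square is the identity (`exists_involution_of_symmetric_orthonormal`). The
normalized indicator functions of the lattice points identify `L²_q` with an `ℓ²` space
(`exists_pointBasis`). In these coordinates the basis functions are the images of the standard unit
vectors under a block-diagonal matrix of this kind, with one block for each sector, and the integral
transform is such a matrix itself.
-/

/-! ### Infinite shifted factorials -/

theorem multipliable_qPochInf (a : ℝ) {b : ℝ} (hb0 : 0 ≤ b) (hb1 : b < 1) :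
    Multipliable fun i : ℕ => 1 - a * b ^ i := by
  have h : Summable fun i : ℕ => -(a * b ^ i) :=
    ((summable_geometric_of_lt_one hb0 hb1).mul_left a).neg
  simpa [sub_eq_add_neg] using Real.multipliable_one_add_of_summable h

theorem tendsto_qPoch (a : ℝ) {b : ℝ} (hb0 : 0 ≤ b) (hb1 : b < 1) :
    Filter.Tendsto (qPoch a b) Filter.atTop (nhds (qPochInf a b)) :=
  (multipliable_qPochInf a hb0 hb1).hasProd.tendsto_prod_nat

theorem qPoch_succ' (a b : ℝ) (n : ℕ) : qPoch a b (n + 1) = (1 - a) * qPoch (a * b) b n := by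
  simp only [qPoch, Finset.prod_range_succ']
  rw [mul_comm]
  simp [pow_succ', mul_assoc]

theorem qPochInf_eq_mul (a : ℝ) {b : ℝ} (hb0 : 0 ≤ b) (hb1 : b < 1) :
    qPochInf a b = (1 - a) * qPochInf (a * b) b := by
  refine tendsto_nhds_unique
    ((Filter.tendsto_add_atTop_iff_nat 1).2 (tendsto_qPoch a hb0 hb1)) ?_
  simp only [qPoch_succ']
  exact (tendsto_qPoch (a * b) hb0 hb1).const_mul _

theorem qPochInf_mem_Icc {a b : ℝ} (ha0 : 0 ≤ a) (ha1 : a ≤ 1) (hb0 : 0 ≤ b) (hb1 : b < 1) :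
    qPochInf a b ∈ Set.Icc (0 : ℝ) 1 := by
  have h (i : ℕ) : a * b ^ i ∈ Set.Icc (0 : ℝ) 1 :=
    ⟨by positivity, mul_le_one₀ ha1 (by positivity) (pow_le_one₀ hb0 hb1.le)⟩
  constructor
  · refine ge_of_tendsto' (tendsto_qPoch a hb0 hb1) fun n => Finset.prod_nonneg fun i _ => ?_
    linarith [(h i).2]
  · refine le_of_tendsto' (tendsto_qPoch a hb0 hb1) fun n =>
      Finset.prod_le_one (fun i _ => ?_) fun i _ => ?_
    · linarith [(h i).2]
    · linarith [(h i).1]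

theorem qPochInf_pos {a b : ℝ} (ha0 : 0 ≤ a) (ha1 : a < 1) (hb0 : 0 ≤ b) (hb1 : b < 1) :
    0 < qPochInf a b := by
  refine lt_of_le_of_ne (qPochInf_mem_Icc ha0 ha1.le hb0 hb1).1 (Ne.symm ?_)
  have hs : Summable fun i : ℕ => ‖-(a * b ^ i)‖ :=
    ((summable_geometric_of_lt_one hb0 hb1).mul_left a).neg.norm
  have h := tprod_one_add_ne_zero_of_summable (f := fun i : ℕ => -(a * b ^ i)) (fun i => ?_) hs
  · simpa [qPochInf, sub_eq_add_neg] using h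
  · have : a * b ^ i < 1 := mul_lt_one_of_nonneg_of_lt_one_left ha0 ha1 (pow_le_one₀ hb0 hb1.le)
    intro h
    linarith

theorem qPochInf_eq_zero {a b : ℝ} (hb0 : 0 ≤ b) (hb1 : b < 1) {n : ℕ} (h : a * b ^ n = 1) :
    qPochInf a b = 0 := by
  refine tendsto_nhds_unique (tendsto_qPoch a hb0 hb1) (tendsto_const_nhds.congr' ?_)
  filter_upwards [Filter.eventually_gt_atTop n] with m hm
  exact (Finset.prod_eq_zero (Finset.mem_range.2 hm) (by rw [h, sub_self])).symm

/-! ### The reciprocal shifted factorials -/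

/-- The coefficient `1 / (p²; p²)_n` with an index `n ∈ ℤ`, encoded as
`(p^{2(n+1)}; p²)_∞ / (p²; p²)_∞`, so that it vanishes for `n < 0`. -/
noncomputable def invPoch (p : ℝ) (n : ℤ) : ℝ :=
  qPochInf (p ^ (2 * (n + 1))) (p ^ 2) / qPochInf (p ^ 2) (p ^ 2)

section

variable {p : ℝ}

theorem sq_lt_one_of_pos (hp0 : 0 < p) (hp1 : p < 1) : p ^ 2 < 1 :=
  pow_lt_one₀ hp0.le hp1 two_ne_zero

/-- The recurrence holds for all `n ∈ ℤ`: for `n ≤ 0` both sides vanish. -/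
theorem invPoch_recurrence (hp0 : 0 < p) (hp1 : p < 1) (n : ℤ) :
    (1 - p ^ (2 * n)) * invPoch p n = invPoch p (n - 1) := by
  have h := qPochInf_eq_mul (p ^ (2 * n)) (sq_nonneg p) (sq_lt_one_of_pos hp0 hp1)
  have h2 : p ^ (2 * n) * p ^ 2 = p ^ (2 * (n + 1)) := by
    rw [mul_add, zpow_add₀ hp0.ne']; norm_cast
  rw [h2] at h
  rw [invPoch, invPoch, sub_add_cancel, h, mul_div_assoc]

theorem invPoch_zero (hp0 : 0 < p) (hp1 : p < 1) : invPoch p 0 = 1 := by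
  have h := qPochInf_pos (sq_nonneg p) (sq_lt_one_of_pos hp0 hp1) (sq_nonneg p)
    (sq_lt_one_of_pos hp0 hp1)
  have h2 : p ^ (2 * ((0 : ℤ) + 1)) = p ^ 2 := by norm_cast
  rw [invPoch, h2, div_self h.ne']

theorem invPoch_of_neg (hp0 : 0 < p) (hp1 : p < 1) {n : ℤ} (hn : n < 0) : invPoch p n = 0 := by
  obtain ⟨m, rfl⟩ : ∃ m : ℕ, n = -(m : ℤ) - 1 := ⟨(-n - 1).toNat, by omega⟩
  rw [invPoch, qPochInf_eq_zero (n := m) (sq_nonneg p) (sq_lt_one_of_pos hp0 hp1), zero_div]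
  rw [← zpow_natCast, ← zpow_natCast, ← zpow_mul, ← zpow_add₀ hp0.ne']
  push_cast
  ring_nf
  simp

theorem invPoch_nonneg (hp0 : 0 < p) (hp1 : p < 1) (n : ℤ) : 0 ≤ invPoch p n := by
  rcases lt_or_ge n 0 with hn | hn
  · rw [invPoch_of_neg hp0 hp1 hn]
  · exact div_nonneg (qPochInf_mem_Icc (by positivity)
      (zpow_le_one₀ hp0 hp1.le (by omega)) (sq_nonneg p)
      (sq_lt_one_of_pos hp0 hp1)).1 (qPochInf_pos (sq_nonneg p) (sq_lt_one_of_pos hp0 hp1)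
        (sq_nonneg p) (sq_lt_one_of_pos hp0 hp1)).le

theorem exists_invPoch_le (hp0 : 0 < p) (hp1 : p < 1) :
    ∃ E : ℝ, 0 ≤ E ∧ ∀ n, invPoch p n ≤ E := by
  have h := qPochInf_pos (sq_nonneg p) (sq_lt_one_of_pos hp0 hp1) (sq_nonneg p)
    (sq_lt_one_of_pos hp0 hp1)
  refine ⟨1 / qPochInf (p ^ 2) (p ^ 2), by positivity, fun n => ?_⟩
  rcases lt_or_ge n 0 with hn | hn
  · rw [invPoch_of_neg hp0 hp1 hn]; positivity
  · exact div_le_div_of_nonneg_right (qPochInf_mem_Icc (by positivity)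
      (zpow_le_one₀ hp0 hp1.le (by omega)) (sq_nonneg p)
      (sq_lt_one_of_pos hp0 hp1)).2 h.le

end

/-! ### Euler's expansion -/

/-- Gaussian decay beats geometric growth; the series is compared with the one bounding the Jacobi
theta function. -/
theorem summable_zpow_sq_mul_zpow {p : ℝ} (hp0 : 0 < p) (hp1 : p < 1) {b : ℝ} (hb : 0 < b) :
    Summable fun n : ℤ => p ^ (n * n) * b ^ n := by
  have hT : 0 < -Real.log p / Real.pi := div_pos (neg_pos.2 (Real.log_neg hp0 hp1)) Real.pi_pos
  refine Summable.of_nonneg_of_le (fun n => by positivity) (fun n => ?_)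
    (summable_pow_mul_jacobiTheta₂_term_bound (|Real.log b| / (2 * Real.pi)) hT 0)
  have h1 : p ^ (n * n) * b ^ n = Real.exp (Real.log p * (n : ℝ) ^ 2 + Real.log b * n) := by
    rw [Real.exp_add, mul_comm (Real.log p), mul_comm (Real.log b), ← Real.log_zpow]
    rw [← Int.cast_pow, ← Real.log_zpow, Real.exp_log (by positivity),
      Real.exp_log (by positivity), sq]
  rw [h1, pow_zero, one_mul, Real.exp_le_exp]
  have h2 : -Real.pi * (-Real.log p / Real.pi * (n : ℝ) ^ 2 -
      2 * (|Real.log b| / (2 * Real.pi)) * ((|n| : ℤ) : ℝ)) =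
      Real.log p * (n : ℝ) ^ 2 + |Real.log b| * |(n : ℝ)| := by
    have := Real.pi_ne_zero
    push_cast
    field_simp
    ring
  rw [h2, ← abs_mul]
  gcongr
  exact le_abs_self _

/-- The term `(-1)^n p^{n²-n} a^n / (p²; p²)_n` of Euler's expansion of `(a; p²)_∞`. -/
noncomputable def eulerTerm (p a : ℝ) (n : ℤ) : ℝ :=
  (-1) ^ n * p ^ (n * n - n) * a ^ n * invPoch p n

theorem summable_eulerTerm {p : ℝ} (hp0 : 0 < p) (hp1 : p < 1) {a : ℝ} (ha : 0 < a) :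
    Summable (eulerTerm p a) := by
  obtain ⟨E, hE0, hE⟩ := exists_invPoch_le hp0 hp1
  refine Summable.of_norm_bounded
    ((summable_zpow_sq_mul_zpow hp0 hp1 (div_pos ha hp0)).mul_right E) fun n => ?_
  rw [eulerTerm, Real.norm_eq_abs, abs_mul, abs_mul, abs_mul, abs_neg_one_zpow, one_mul,
    abs_of_nonneg (invPoch_nonneg hp0 hp1 n), abs_of_pos (by positivity : 0 < a ^ n),
    abs_of_pos (by positivity : 0 < p ^ (n * n - n)), zpow_sub₀ hp0.ne', div_zpow]
  have := hE n
  calc p ^ (n * n) / p ^ n * a ^ n * invPoch p n ≤ p ^ (n * n) / p ^ n * a ^ n * E := by gcongr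
    _ = _ := by ring

theorem tsum_eulerTerm_eq_mul {p : ℝ} (hp0 : 0 < p) (hp1 : p < 1) {a : ℝ} (ha : 0 < a) :
    ∑' n, eulerTerm p a n = (1 - a) * ∑' n, eulerTerm p (a * p ^ 2) n := by
  have h1 := (summable_eulerTerm hp0 hp1 ha).hasSum
  have h2 := (summable_eulerTerm hp0 hp1 (a := a * p ^ 2) (by positivity)).hasSum
  have h3 := ((Equiv.subRight (1 : ℤ)).hasSum_iff.2 h2).mul_left (-a)
  have h4 : HasSum (fun n => eulerTerm p a n - eulerTerm p (a * p ^ 2) n) _ := h3.congr_fun ?_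
  · have := (h1.sub h2).unique h4
    linarith
  · intro n
    simp only [Function.comp_apply, Equiv.subRight_apply, eulerTerm]
    rw [← invPoch_recurrence hp0 hp1 n, mul_zpow, ← zpow_natCast, ← zpow_mul, mul_zpow,
      zpow_sub_one₀ ha.ne', zpow_sub_one₀ (by norm_num : (-1 : ℝ) ≠ 0), ← zpow_mul]
    have e : p ^ ((n - 1) * (n - 1) - (n - 1)) * p ^ (((2 : ℕ) : ℤ) * (n - 1)) =
        p ^ (n * n - n) := by
      rw [← zpow_add₀ hp0.ne']; congr 1; push_cast; ring
    push_cast at e ⊢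
    field_simp
    linear_combination (-(1 - p ^ (2 * n)) * invPoch p n) * e

/-- Euler's expansion `∑ (-1)^n p^{n²-n} a^n / (p²; p²)_n = (a; p²)_∞`. Iterating the functional
equation `f(a) = (1 - a) f(a p²)` reduces it to `f(0) = 1`. -/
theorem hasSum_eulerTerm {p : ℝ} (hp0 : 0 < p) (hp1 : p < 1) {a : ℝ} (ha : 0 < a) :
    HasSum (eulerTerm p a) (qPochInf a (p ^ 2)) := by
  have hr := sq_lt_one_of_pos hp0 hp1
  have key (n : ℕ) : ∑' l, eulerTerm p a l =
      qPoch a (p ^ 2) n * ∑' l, eulerTerm p (a * (p ^ 2) ^ n) l := by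
    induction n with
    | zero => simp [qPoch]
    | succ n ih =>
      rw [ih, tsum_eulerTerm_eq_mul hp0 hp1 (by positivity), qPoch, qPoch,
        Finset.prod_range_succ, pow_succ _ n, ← mul_assoc a]
      ring
  have hlim : Filter.Tendsto (fun n : ℕ => ∑' l, eulerTerm p (a * (p ^ 2) ^ n) l) Filter.atTop
      (nhds (∑' l : ℤ, if l = 0 then 1 else 0)) := by
    refine tendsto_tsum_of_dominated_convergence (summable_eulerTerm hp0 hp1 ha).norm ?_ ?_
    · intro l
      rcases lt_trichotomy l 0 with hl | rfl | hl
      · simp [eulerTerm, invPoch_of_neg hp0 hp1 hl, hl.ne]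
      · simp [eulerTerm, invPoch_zero hp0 hp1]
      · lift l to ℕ using hl.le
        have hl' : l ≠ 0 := by rintro rfl; simp at hl
        have : Filter.Tendsto (fun n : ℕ => (a * (p ^ 2) ^ n) ^ (l : ℤ)) Filter.atTop
            (nhds 0) := by
          have := ((tendsto_pow_atTop_nhds_zero_of_lt_one (sq_nonneg p) hr).const_mul a).pow l
          simpa [hl'] using this
        have := (this.const_mul ((-1) ^ (l : ℤ) * p ^ ((l : ℤ) * l - l))).mul_const
          (invPoch p l)
        simpa [eulerTerm, hl'] using this
    · refine Filter.Eventually.of_forall fun n l => ?_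
      rcases lt_or_ge l 0 with hl | hl
      · simp [eulerTerm, invPoch_of_neg hp0 hp1 hl]
      · lift l to ℕ using hl
        simp only [eulerTerm, norm_mul]
        gcongr
        simp only [zpow_natCast, norm_pow, norm_mul]
        gcongr
        refine mul_le_of_le_one_right (norm_nonneg a) (pow_le_one₀ (by positivity) ?_)
        rw [← norm_pow, Real.norm_of_nonneg (sq_nonneg p)]
        exact hr.le
  have h2 := (tendsto_qPoch a (sq_nonneg p) hr).mul hlim
  simp only [tsum_ite_eq, mul_one] at h2
  have h3 := tendsto_nhds_unique (h2.congr fun n => (key n).symm) tendsto_const_nhds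
  rw [h3]
  exact (summable_eulerTerm hp0 hp1 ha).hasSum

/-- The coefficients of `(t; p²)_∞ · 1 / (t; p²)_∞ = 1`. After multiplication by `1 - p^{2K}` the
sum telescopes. -/
theorem hasSum_invPoch_mul_invPoch {p : ℝ} (hp0 : 0 < p) (hp1 : p < 1) (K : ℤ) :
    HasSum (fun n : ℤ => (-1) ^ n * p ^ (n * n - n) * invPoch p n * invPoch p (K - n))
      (if K = 0 then 1 else 0) := by
  rcases eq_or_ne K 0 with rfl | hK
  · have h := hasSum_single (f := fun n : ℤ =>
      (-1) ^ n * p ^ (n * n - n) * invPoch p n * invPoch p (0 - n)) 0 fun n hn => ?_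
    · simpa [invPoch_zero hp0 hp1] using h
    · rcases lt_or_gt_of_ne hn with h | h
      · simp [invPoch_of_neg hp0 hp1 h]
      · rw [invPoch_of_neg hp0 hp1 (n := 0 - n) (by omega), mul_zero]
  · rw [if_neg hK]
    have hK' : 1 - p ^ (2 * K) ≠ 0 := by
      intro h
      have h1 : p ^ (2 * K) = 1 := by linarith
      rw [zpow_eq_one_iff_right₀ hp0.le hp1.ne] at h1
      omega
    set g : ℤ → ℝ := fun n => (-1) ^ n * p ^ (n * n + n) * invPoch p n * invPoch p (K - 1 - n)
    have hg : Summable g := by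
      refine summable_of_ne_finset_zero (s := Finset.Icc 0 (K - 1)) fun n hn => ?_
      rw [Finset.mem_Icc, not_and_or] at hn
      rcases hn with h | h
      · simp [g, invPoch_of_neg hp0 hp1 (not_le.1 h)]
      · simp [g, invPoch_of_neg hp0 hp1 (n := K - 1 - n) (by omega)]
    have h1 := hg.hasSum.sub ((Equiv.subRight (1 : ℤ)).hasSum_iff.2 hg.hasSum)
    rw [sub_self] at h1
    have h2 := h1.mul_left (1 - p ^ (2 * K))⁻¹
    rw [mul_zero] at h2
    refine h2.congr_fun fun n => ?_
    rw [eq_inv_mul_iff_mul_eq₀ hK']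
    simp only [g, Function.comp_apply, Equiv.subRight_apply]
    have e1 := invPoch_recurrence hp0 hp1 n
    have e2 := invPoch_recurrence hp0 hp1 (K - n)
    rw [show K - 1 - n = K - n - 1 by ring, show K - 1 - (n - 1) = K - n by ring, ← e1, ← e2,
      zpow_sub_one₀ (by norm_num : (-1 : ℝ) ≠ 0),
      show (n - 1) * (n - 1) + (n - 1) = n * n - n by ring,
      show n * n + n = (n * n - n) + 2 * n by ring, zpow_add₀ hp0.ne' (n * n - n),
      show 2 * (K - n) = 2 * K - 2 * n by ring, zpow_sub₀ hp0.ne' (2 * K)]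
    field_simp
    ring

/-! ### The `q`-trigonometric functions as correlations -/

/-- The coefficients of `(p^{θ+1} t; p²)_∞`, with `θ = 0` for the cosine and `θ = 1` for the
sine. -/
noncomputable def alphaCoeff (p : ℝ) (θ : ℕ) (n : ℤ) : ℝ :=
  (-1) ^ n * p ^ (n * n + θ * n) * invPoch p n

/-- The coefficients of `1 / (p^θ t; p²)_∞`. -/
noncomputable def betaCoeff (p : ℝ) (θ : ℕ) (n : ℤ) : ℝ := p ^ (θ * n) * invPoch p n

section

variable {p : ℝ}

theorem alphaCoeff_eq_eulerTerm (hp0 : 0 < p) (θ : ℕ) (n : ℤ) :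
    alphaCoeff p θ n = eulerTerm p (p ^ ((θ : ℤ) + 1)) n := by
  rw [alphaCoeff, eulerTerm, ← zpow_mul, mul_assoc ((-1) ^ n) (p ^ _) (p ^ _), ← zpow_add₀ hp0.ne']
  congr 3
  ring

theorem zpow_neg_mul_alphaCoeff (hp0 : 0 < p) (θ : ℕ) (n : ℤ) :
    p ^ (-n) * alphaCoeff p θ n = eulerTerm p (p ^ (θ : ℤ)) n := by
  rw [alphaCoeff, eulerTerm, ← zpow_mul, mul_assoc ((-1) ^ n) (p ^ _) (p ^ _), ← zpow_add₀ hp0.ne',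
    mul_assoc, mul_left_comm, ← mul_assoc (p ^ (-n)), ← zpow_add₀ hp0.ne', ← mul_assoc]
  congr 3
  ring

theorem betaCoeff_nonneg (hp0 : 0 < p) (hp1 : p < 1) (θ : ℕ) (n : ℤ) : 0 ≤ betaCoeff p θ n :=
  mul_nonneg (by positivity) (invPoch_nonneg hp0 hp1 n)

theorem betaCoeff_le_invPoch (hp0 : 0 < p) (hp1 : p < 1) (θ : ℕ) (n : ℤ) :
    betaCoeff p θ n ≤ invPoch p n := by
  rcases lt_or_ge n 0 with hn | hn
  · simp [betaCoeff, invPoch_of_neg hp0 hp1 hn]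
  · exact mul_le_of_le_one_left (invPoch_nonneg hp0 hp1 n) (zpow_le_one₀ hp0 hp1.le (by positivity))

theorem summable_zpow_mul_betaCoeff (hp0 : 0 < p) (hp1 : p < 1) (θ : ℕ) :
    Summable fun n : ℤ => p ^ n * betaCoeff p θ n := by
  obtain ⟨E, hE0, hE⟩ := exists_invPoch_le hp0 hp1
  rw [← (Nat.cast_injective (R := ℤ)).summable_iff]
  · refine Summable.of_nonneg_of_le (fun n => ?_) (fun n => ?_)
      ((summable_geometric_of_lt_one hp0.le hp1).mul_right E)
    · exact mul_nonneg (by positivity) (betaCoeff_nonneg hp0 hp1 θ _)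
    · have := (betaCoeff_le_invPoch hp0 hp1 θ n).trans (hE n)
      simp only [Function.comp_apply, zpow_natCast]
      gcongr
  · intro n hn
    have : n < 0 := by
      by_contra h
      exact hn ⟨n.toNat, by simpa using h⟩
    simp [betaCoeff, invPoch_of_neg hp0 hp1 this]

theorem hasSum_zpow_mul_betaCoeff_mul_alphaCoeff (hp0 : 0 < p) (hp1 : p < 1) (θ : ℕ) (K : ℤ) :
    HasSum (fun i : ℤ => p ^ i * betaCoeff p θ i * alphaCoeff p θ (K - i))
      (if K = 0 then 1 else 0) := by
  have h := ((Equiv.subLeft K).hasSum_iff.2 (hasSum_invPoch_mul_invPoch hp0 hp1 K)).mul_left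
    (p ^ ((1 + θ) * K))
  have e : p ^ ((1 + θ) * K) * (if K = 0 then 1 else 0) = if K = 0 then 1 else 0 := by
    split_ifs with hK <;> simp [hK]
  rw [e] at h
  refine h.congr_fun fun i => ?_
  simp only [Function.comp_apply, Equiv.subLeft_apply, alphaCoeff, betaCoeff, sub_sub_cancel]
  have e2 : p ^ i * p ^ (θ * i) * p ^ ((K - i) * (K - i) + θ * (K - i)) =
      p ^ ((1 + θ) * K) * p ^ ((K - i) * (K - i) - (K - i)) := by
    rw [← zpow_add₀ hp0.ne', ← zpow_add₀ hp0.ne', ← zpow_add₀ hp0.ne']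
    congr 1
    ring
  linear_combination ((-1) ^ (K - i) * invPoch p i * invPoch p (K - i)) * e2

theorem hasSum_zpow_neg_mul_alphaCoeff_mul_betaCoeff (hp0 : 0 < p) (hp1 : p < 1) (θ : ℕ) (d : ℤ) :
    HasSum (fun n : ℤ => p ^ (-n) * alphaCoeff p θ n * betaCoeff p θ (d - n))
      (if d = 0 then 1 else 0) := by
  have h := (hasSum_invPoch_mul_invPoch hp0 hp1 d).mul_left (p ^ (θ * d))
  have e : p ^ (θ * d) * (if d = 0 then 1 else 0) = if d = 0 then 1 else 0 := by
    split_ifs with hK <;> simp [hK]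
  rw [e] at h
  refine h.congr_fun fun n => ?_
  simp only [alphaCoeff, betaCoeff]
  have e2 : p ^ (-n) * p ^ (n * n + θ * n) * p ^ (θ * (d - n)) =
      p ^ (θ * d) * p ^ (n * n - n) := by
    rw [← zpow_add₀ hp0.ne', ← zpow_add₀ hp0.ne', ← zpow_add₀ hp0.ne']
    congr 1
    ring
  linear_combination ((-1) ^ n * invPoch p n * invPoch p (d - n)) * e2

/-- The correlations `t_j = ∑ α_n β_{n+j}` are the Laurent coefficients of
`M(z) = (p^{θ+1}/z; p²)_∞ / (p^θ z; p²)_∞`. Their orthogonality is `M(z) M(p/z) = 1`, which is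
proved here by regrouping an absolutely convergent triple series. -/
theorem hasSum_correlation_mul_correlation (hp0 : 0 < p) (hp1 : p < 1) (θ : ℕ) {t : ℤ → ℝ}
    (ht : ∀ j, HasSum (fun n => alphaCoeff p θ n * betaCoeff p θ (n + j)) (t j)) (d : ℤ) :
    HasSum (fun k : ℤ => p ^ k * (t k * t (k + d))) (if d = 0 then 1 else 0) := by
  obtain ⟨E, hE0, hE⟩ := exists_invPoch_le hp0 hp1
  set α := alphaCoeff p θ
  set β := betaCoeff p θ
  have hβ0 : ∀ n, 0 ≤ β n := betaCoeff_nonneg hp0 hp1 θ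
  have hβ (n : ℤ) : β n ≤ E := (betaCoeff_le_invPoch hp0 hp1 θ n).trans (hE n)
  have hα : Summable fun n => |α n| := by
    simpa only [α, alphaCoeff_eq_eulerTerm hp0] using
      (summable_eulerTerm hp0 hp1 (by positivity)).abs
  have hα' : Summable fun n => |p ^ (-n) * α n| := by
    simpa only [α, zpow_neg_mul_alphaCoeff hp0] using
      (summable_eulerTerm hp0 hp1 (by positivity)).abs
  have hpβ : Summable fun n => p ^ n * β n := summable_zpow_mul_betaCoeff hp0 hp1 θ
  set Φ : ℤ × ℤ × ℤ → ℝ := fun x =>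
    p ^ x.1 * ((α x.2.1 * β (x.2.1 + x.1)) * (α x.2.2 * β (x.2.2 + (x.1 + d)))) with hΦ
  -- the substitution `i = n + k` separates the variables up to a bounded factor
  let e₁ : (ℤ × ℤ) × ℤ ≃ ℤ × ℤ × ℤ :=
    { toFun := fun x => (x.2 - x.1.1, x.1.1, x.1.2)
      invFun := fun y => ((y.2.1, y.2.2), y.1 + y.2.1)
      left_inv := fun x => by ext <;> simp
      right_inv := fun x => by ext <;> simp }
  have hs : Summable Φ := by
    rw [← e₁.summable_iff]
    have hb := ((hα'.mul_of_nonneg hα (fun _ => abs_nonneg _) (fun _ => abs_nonneg _)).mul_of_nonneg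
      hpβ (fun _ => by positivity) (fun n => mul_nonneg (by positivity) (hβ0 n))).mul_right E
    refine Summable.of_norm_bounded hb fun ⟨⟨n, m⟩, i⟩ => ?_
    have h1 : Φ (i - n, n, m) = ((p ^ (-n) * α n) * α m * (p ^ i * β i)) * β (m + (i - n + d)) := by
      simp only [hΦ]
      rw [add_sub_cancel, sub_eq_add_neg i n, zpow_add₀ hp0.ne']
      ring
    simp only [Function.comp_apply, e₁, Equiv.coe_fn_mk, h1]
    rw [norm_mul, norm_mul, norm_mul, Real.norm_eq_abs, Real.norm_eq_abs, Real.norm_eq_abs,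
      Real.norm_eq_abs, abs_of_nonneg (hβ0 _),
      abs_of_nonneg (mul_nonneg (by positivity) (hβ0 _) : 0 ≤ p ^ i * β i)]
    exact mul_le_mul_of_nonneg_left (hβ _)
      (mul_nonneg (by positivity) (mul_nonneg (by positivity) (hβ0 _)))
  have hk := hs.hasSum.prod_fiberwise (g := fun k => p ^ k * (t k * t (k + d))) fun k => by
    refine ((ht k).mul (ht (k + d)) ?_).mul_left (p ^ k)
    have := hs.prod_factor k
    simp only [hΦ] at this
    rwa [summable_mul_left_iff (zpow_ne_zero k hp0.ne')] at this
  -- grouping by `n` and `K = m + i` uses the generating function identity twice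
  let e₂ : (ℤ × ℤ) × ℤ ≃ ℤ × ℤ × ℤ :=
    { toFun := fun x => (x.2 - x.1.1, x.1.1, x.1.2 - x.2)
      invFun := fun y => ((y.2.1, y.2.2 + (y.1 + y.2.1)), y.1 + y.2.1)
      left_inv := fun x => by ext <;> simp
      right_inv := fun x => by ext <;> simp }
  have h1 := (e₂.hasSum_iff.2 hs.hasSum).prod_fiberwise
    (g := fun x : ℤ × ℤ =>
      p ^ (-x.1) * α x.1 * β (x.2 - x.1 + d) * if x.2 = 0 then 1 else 0)
    fun ⟨n, K⟩ => by
      refine ((hasSum_zpow_mul_betaCoeff_mul_alphaCoeff hp0 hp1 θ K).mul_left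
        (p ^ (-n) * α n * β (K - n + d))).congr_fun fun i => ?_
      simp only [Function.comp_apply, e₂, Equiv.coe_fn_mk, hΦ]
      rw [add_sub_cancel, sub_eq_add_neg i n, zpow_add₀ hp0.ne',
        show K - i + (i + -n + d) = K - n + d by ring]
      ring
  have h2 := h1.prod_fiberwise (g := fun n => p ^ (-n) * α n * β (d - n)) fun n => by
    convert hasSum_single (f := fun K : ℤ => p ^ (-n) * α n * β (K - n + d) *
      if K = 0 then 1 else 0) 0 (fun K hK => by simp [hK]) using 1
    simp only [if_true, mul_one]
    congr 2
    ring
  rwa [h2.unique (hasSum_zpow_neg_mul_alphaCoeff_mul_betaCoeff hp0 hp1 θ d)] at hk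

/-- Expanding `β_{n+j}` by Euler's formula and summing over `n` first turns the correlation into a
power series in `p^j`. -/
theorem exists_hasSum_correlation (hp0 : 0 < p) (hp1 : p < 1) (θ : ℕ) (j : ℤ) :
    ∃ S, HasSum (fun n => alphaCoeff p θ n * betaCoeff p θ (n + j)) S ∧
      HasSum (fun l : ℤ => (qPochInf (p ^ 2) (p ^ 2))⁻¹ *
        ((-1) ^ l * p ^ (l * l + l + (2 * l + θ) * j) * invPoch p l *
          qPochInf (p ^ (2 * l + 2 * θ + 1)) (p ^ 2))) S := by
  obtain ⟨E, hE0, hE⟩ := exists_invPoch_le hp0 hp1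
  set c := (qPochInf (p ^ 2) (p ^ 2))⁻¹ with hc
  have hc0 : 0 ≤ c := inv_nonneg.2 (qPochInf_pos (sq_nonneg p) (sq_lt_one_of_pos hp0 hp1)
    (sq_nonneg p) (sq_lt_one_of_pos hp0 hp1)).le
  have he (n : ℤ) : invPoch p n = c * qPochInf (p ^ (2 * (n + 1))) (p ^ 2) := by
    rw [invPoch, hc, div_eq_inv_mul]
  set A : ℤ × ℤ → ℝ := fun x =>
    c * ((-1) ^ x.1 * (-1) ^ x.2 * p ^ (x.1 * x.1 + 2 * θ * x.1 + θ * j + x.2 * x.2 - x.2 +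
      2 * x.2 * (x.1 + j + 1)) * (invPoch p x.1 * invPoch p x.2)) with hA
  have hs : Summable A := by
    have h1 := summable_zpow_sq_mul_zpow hp0 hp1 (b := p ^ (2 * (θ : ℤ))) (by positivity)
    have h2 := summable_zpow_sq_mul_zpow hp0 hp1 (b := p ^ (2 * j + 1)) (by positivity)
    refine Summable.of_norm_bounded ((h1.mul_of_nonneg h2 (fun _ => by positivity)
      (fun _ => by positivity)).mul_left (c * p ^ (θ * j) * (E * E))) fun ⟨n, l⟩ => ?_
    have hb : p ^ (2 * n * l) * (invPoch p n * invPoch p l) ≤ E * E := by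
      rcases lt_or_ge n 0 with hn | hn
      · rw [invPoch_of_neg hp0 hp1 hn]; simp; positivity
      rcases lt_or_ge l 0 with hl | hl
      · rw [invPoch_of_neg hp0 hp1 hl]; simp; positivity
      have h3 := invPoch_nonneg hp0 hp1 n
      have h4 := invPoch_nonneg hp0 hp1 l
      calc _ ≤ 1 * (invPoch p n * invPoch p l) := by
            gcongr
            exact zpow_le_one₀ hp0 hp1.le (by positivity)
        _ ≤ E * E := by
          rw [one_mul]
          exact mul_le_mul (hE n) (hE l) h4 hE0
    have e : p ^ (n * n + 2 * θ * n + θ * j + l * l - l + 2 * l * (n + j + 1)) =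
        p ^ (θ * j) * ((p ^ (n * n) * (p ^ (2 * (θ : ℤ))) ^ n) *
          (p ^ (l * l) * (p ^ (2 * j + 1)) ^ l)) * p ^ (2 * n * l) := by
      simp only [← zpow_mul, ← zpow_add₀ hp0.ne']
      congr 1
      ring
    simp only [hA, e, norm_mul, Real.norm_eq_abs, abs_neg_one_zpow, one_mul, abs_of_nonneg hc0,
      abs_of_nonneg (invPoch_nonneg hp0 hp1 _)]
    simp only [← norm_mul, ← Real.norm_eq_abs]
    rw [Real.norm_of_nonneg (by positivity)]
    have := mul_le_mul_of_nonneg_left hb (show 0 ≤ c * (p ^ (θ * j) *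
      ((p ^ (n * n) * (p ^ (2 * (θ : ℤ))) ^ n) * (p ^ (l * l) * (p ^ (2 * j + 1)) ^ l))) by
        positivity)
    refine le_trans (le_of_eq ?_) (this.trans (le_of_eq ?_)) <;> ring
  refine ⟨∑' x, A x, hs.hasSum.prod_fiberwise fun n => ?_,
    ((Equiv.prodComm ℤ ℤ).hasSum_iff.2 hs.hasSum).prod_fiberwise fun l => ?_⟩
  · have h := (hasSum_eulerTerm hp0 hp1 (a := p ^ (2 * (n + j + 1))) (by positivity)).mul_left
      (c * alphaCoeff p θ n * p ^ (θ * (n + j)))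
    rw [show alphaCoeff p θ n * betaCoeff p θ (n + j) = c * alphaCoeff p θ n * p ^ (θ * (n + j)) *
      qPochInf (p ^ (2 * (n + j + 1))) (p ^ 2) by rw [betaCoeff, he (n + j)]; ring]
    refine h.congr_fun fun l => ?_
    simp only [hA, eulerTerm, alphaCoeff]
    have e : p ^ (n * n + 2 * θ * n + θ * j + l * l - l + 2 * l * (n + j + 1)) =
        p ^ (n * n + θ * n) * p ^ (θ * (n + j)) * (p ^ (l * l - l) *
          (p ^ (2 * (n + j + 1))) ^ l) := by
      simp only [← zpow_mul, ← zpow_add₀ hp0.ne']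
      congr 1
      ring
    rw [e]
    ring
  · have h := (hasSum_eulerTerm hp0 hp1 (a := p ^ (2 * l + 2 * θ + 1)) (by positivity)).mul_left
      (c * ((-1) ^ l * p ^ (l * l + l + (2 * l + θ) * j) * invPoch p l))
    rw [← mul_assoc c]
    refine h.congr_fun fun n => ?_
    simp only [hA, eulerTerm, Function.comp_apply, Equiv.prodComm_apply, Prod.swap]
    have e : p ^ (n * n + 2 * θ * n + θ * j + l * l - l + 2 * l * (n + j + 1)) =
        p ^ (l * l + l + (2 * l + θ) * j) * (p ^ (n * n - n) *
          (p ^ (2 * l + 2 * θ + 1)) ^ n) := by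
      simp only [← zpow_mul, ← zpow_add₀ hp0.ne']
      congr 1
      ring
    rw [e]
    ring

/-- The splitting `(p; p)_{2l} = (p²; p²)_l (p; p²)_l`. -/
theorem invPoch_mul_qPochInf_mul_qPoch (hp0 : 0 < p) (hp1 : p < 1) (l : ℕ) :
    invPoch p l * qPochInf (p ^ (2 * (l : ℤ) + 1)) (p ^ 2) * qPoch p p (2 * l) =
      qPochInf p (p ^ 2) := by
  induction l with
  | zero => simp [invPoch_zero hp0 hp1, qPoch]
  | succ l ih =>
    have h1 := invPoch_recurrence hp0 hp1 ((l : ℤ) + 1)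
    have h2 := qPochInf_eq_mul (p ^ (2 * (l : ℤ) + 1)) (sq_nonneg p) (sq_lt_one_of_pos hp0 hp1)
    have h3 : p ^ (2 * (l : ℤ) + 1) * p ^ 2 = p ^ (2 * ((l : ℤ) + 1) + 1) := by
      rw [← zpow_natCast, ← zpow_add₀ hp0.ne']; congr 1
    have h4 : qPoch p p (2 * (l + 1)) =
        qPoch p p (2 * l) * (1 - p ^ (2 * (l : ℤ) + 1)) * (1 - p ^ (2 * ((l : ℤ) + 1))) := by
      rw [qPoch, mul_add, Finset.prod_range_succ, Finset.prod_range_succ, qPoch, ← pow_succ',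
        ← pow_succ']
      norm_cast
    rw [add_sub_cancel_right] at h1
    rw [h3] at h2
    rw [← ih, h4, h2, ← h1]
    push_cast
    ring

theorem qPoch_self_ne_zero (hp0 : 0 < p) (hp1 : p < 1) (n : ℕ) : qPoch p p n ≠ 0 := by
  refine Finset.prod_ne_zero_iff.2 fun i _ => ?_
  rw [← pow_succ']
  have := pow_lt_one₀ hp0.le hp1 (Nat.succ_ne_zero i)
  exact (sub_pos.2 this).ne'

/-- For `θ = 0` and `θ = 1` the power series are those of the `q`-cosine and the `q`-sine. -/
theorem hasSum_correlation (hp0 : 0 < p) (hp1 : p < 1) (θ : ℕ) (hθ : θ = 0 ∨ θ = 1) (j : ℤ) :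
    HasSum (fun n => alphaCoeff p θ n * betaCoeff p θ (n + j))
      (qPochInf p (p ^ 2) / qPochInf (p ^ 2) (p ^ 2) *
        ∑' n : ℕ, (-1) ^ n * p ^ ((n : ℤ) * (n + 1)) * (p ^ j) ^ (2 * n + θ)
          / qPoch p p (2 * n + θ)) := by
  obtain ⟨S, h1, h2⟩ := exists_hasSum_correlation hp0 hp1 θ j
  rw [← (Nat.cast_injective (R := ℤ)).hasSum_iff] at h2
  · convert h1
    rw [← tsum_mul_left, ← h2.tsum_eq]
    refine tsum_congr fun l => ?_
    have key : invPoch p l * qPochInf (p ^ (2 * (l : ℤ) + 2 * θ + 1)) (p ^ 2) =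
        qPochInf p (p ^ 2) / qPoch p p (2 * l + θ) := by
      rw [eq_div_iff (qPoch_self_ne_zero hp0 hp1 _), ← invPoch_mul_qPochInf_mul_qPoch hp0 hp1 l]
      rcases hθ with rfl | rfl
      · simp
      · rw [qPochInf_eq_mul (p ^ (2 * (l : ℤ) + 1)) (sq_nonneg p) (sq_lt_one_of_pos hp0 hp1)]
        have h3 : p ^ (2 * (l : ℤ) + 1) * p ^ 2 = p ^ (2 * (l : ℤ) + 2 * (1 : ℕ) + 1) := by
          rw [← zpow_natCast, ← zpow_add₀ hp0.ne']; congr 1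
        have h4 : qPoch p p (2 * l + 1) = qPoch p p (2 * l) * (1 - p ^ (2 * (l : ℤ) + 1)) := by
          rw [qPoch, Finset.prod_range_succ, qPoch, ← pow_succ']
          norm_cast
        rw [h3, h4]
        ring
    have e : p ^ ((l : ℤ) * l + l + (2 * l + θ) * j) =
        p ^ ((l : ℤ) * (l + 1)) * (p ^ j) ^ (2 * l + θ) := by
      rw [← zpow_natCast, ← zpow_mul, ← zpow_add₀ hp0.ne']
      congr 1
      push_cast
      ring
    rw [Function.comp_apply, mul_assoc _ (invPoch p l), key, e, zpow_natCast]
    ring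
  · intro n hn
    have : n < 0 := by
      by_contra h
      exact hn ⟨n.toNat, by simpa using h⟩
    simp [invPoch_of_neg hp0 hp1 this]

end

theorem cosq_neg (q z : ℝ) : cosq q (-z) = cosq q z := by
  simp only [cosq, (even_two_mul _).neg_pow]

theorem sinq_neg (q z : ℝ) : sinq q (-z) = -sinq q z := by
  simp only [sinq, (odd_two_mul_add_one _).neg_pow]
  rw [← tsum_neg]
  exact tsum_congr fun n => by ring

/-- The rescaled values `N_q q^n T(q^{2n})` of `T` on the points of one sector. The matrix
`(n, k) ↦ hankel (n + k)` represents both the basis functions and the integral transform. -/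
noncomputable def hankel (q : ℝ) (T : ℝ → ℝ) (n : ℤ) : ℝ := Nq q * (q ^ n * T (q ^ (2 * n)))

/-- The Hankel matrix of `hankel q T` has orthonormal rows. -/
theorem hasSum_hankel_mul_hankel {q : ℝ} (hq : 1 < q) {T : ℝ → ℝ} (hT : T = cosq q ∨ T = sinq q)
    (n m : ℤ) :
    HasSum (fun k => hankel q T (n + k) * hankel q T (m + k)) (if n = m then 1 else 0) := by
  have hq0 : 0 < q := one_pos.trans hq
  set p := q ^ (-2 : ℤ) with hp
  have hp0 : 0 < p := by positivity
  have hp1 : p < 1 := zpow_lt_one_of_neg₀ hq (by norm_num)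
  have hp2 : q ^ (-4 : ℤ) = p ^ 2 := by rw [hp, ← zpow_natCast, ← zpow_mul]; norm_num
  have hN : Nq q = qPochInf p (p ^ 2) / qPochInf (p ^ 2) (p ^ 2) := by rw [Nq, ← hp, hp2]
  have hpow (l : ℕ) : q ^ (-2 * (l : ℤ) * ((l : ℤ) + 1)) = p ^ ((l : ℤ) * (l + 1)) := by
    rw [hp, ← zpow_mul]; ring_nf
  obtain ⟨θ, ht⟩ : ∃ θ : ℕ, ∀ j, HasSum (fun n => alphaCoeff p θ n * betaCoeff p θ (n + j))
      (Nq q * T (p ^ j)) := by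
    rw [hN]
    rcases hT with rfl | rfl
    · refine ⟨0, fun j => ?_⟩
      simp only [cosq, ← hp, hpow]
      exact hasSum_correlation hp0 hp1 0 (.inl rfl) j
    · refine ⟨1, fun j => ?_⟩
      simp only [sinq, ← hp, hpow]
      exact hasSum_correlation hp0 hp1 1 (.inr rfl) j
  have h := hasSum_correlation_mul_correlation hp0 hp1 θ ht (n - m)
  have h2 := ((Equiv.subLeft (-n)).hasSum_iff.2 h).mul_left (q ^ (m - n))
  have e : q ^ (m - n) * (if n - m = 0 then 1 else 0) = if n = m then 1 else 0 := by
    by_cases hnm : n = m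
    · simp [hnm]
    · simp [hnm, sub_eq_zero]
  rw [e] at h2
  refine h2.congr_fun fun k => ?_
  simp only [hankel, Function.comp_apply, Equiv.subLeft_apply]
  rw [show -n - k + (n - m) = -m - k by ring, hp, ← zpow_mul, ← zpow_mul,
    show -2 * (-n - k) = 2 * (n + k) by ring, show -2 * (-m - k) = 2 * (m + k) by ring]
  have e3 : q ^ (n + k) * q ^ (m + k) = q ^ (m - n) * q ^ (2 * (n + k)) := by
    rw [← zpow_add₀ hq0.ne', ← zpow_add₀ hq0.ne']; congr 1; ring
  linear_combination (Nq q * T (q ^ (2 * (n + k))) * (Nq q * T (q ^ (2 * (m + k))))) * e3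

/-! ### Symmetric orthogonal matrices on `ℓ²` -/

open scoped lp in
/-- A real symmetric matrix with orthonormal rows acts on `ℓ²` as an isometric involution. -/
theorem exists_involution_of_symmetric_orthonormal {ι : Type*} [DecidableEq ι] (M : ι → ι → ℝ)
    (hsymm : ∀ i j, M i j = M j i)
    (hM : ∀ i j, HasSum (fun k => M i k * M j k) (if i = j then 1 else 0)) :
    ∃ U : ℓ²(ι, ℂ) ≃ₗᵢ[ℂ] ℓ²(ι, ℂ), (∀ g, U (U g) = g) ∧
      ∀ g k, HasSum (fun n => (M k n : ℂ) * g n) (U g k) := by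
  have hmem (i : ι) : Memℓp (fun k => (M i k : ℂ)) 2 := by
    refine memℓp_gen ((hM i i).summable.congr fun k => ?_)
    simp [← sq]
  let r (i : ι) : ℓ²(ι, ℂ) := ⟨fun k => (M i k : ℂ), hmem i⟩
  have hr (i k : ι) : r i k = (M i k : ℂ) := rfl
  have horth : Orthonormal ℂ r := by
    rw [orthonormal_iff_ite]
    intro i j
    refine (lp.hasSum_inner (r i) (r j)).unique ?_
    have h := Complex.hasSum_ofReal.2 (hM i j)
    simp only [hr, RCLike.inner_apply, Complex.conj_ofReal]
    refine HasSum.congr_fun (f := fun k => ((M i k * M j k : ℝ) : ℂ)) ?_ fun k => ?_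
    · convert h
      split_ifs <;> simp
    · push_cast; ring
  let U₀ := horth.orthogonalFamily.linearIsometry
  have hU₀ (g : ℓ²(ι, ℂ)) (k : ι) : HasSum (fun n => (M k n : ℂ) * g n) (U₀ g k) := by
    have h := (horth.orthogonalFamily.hasSum_linearIsometry g).mapL
      (lp.evalCLM ℂ (fun _ : ι => ℂ) 2 k)
    refine h.congr_fun fun n => ?_
    simp [hr, hsymm k n, mul_comm, lp.evalCLM]
  have hinv (g : ℓ²(ι, ℂ)) : U₀ (U₀ g) = g := by
    have h1 (i : ι) (a : ℂ) : U₀ (U₀ (lp.single 2 i a)) = lp.single 2 i a := by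
      have h2 : U₀ (lp.single 2 i a) = a • r i := by
        simp [U₀]
      rw [h2, map_smul]
      ext k
      rw [lp.coeFn_smul, Pi.smul_apply]
      have h3 := Complex.hasSum_ofReal.2 (hM k i)
      have h4 : U₀ (r i) k = ((if k = i then 1 else 0 : ℝ) : ℂ) :=
        (hU₀ (r i) k).unique (h3.congr_fun fun n => by simp [hr])
      rw [h4, lp.single_apply]
      by_cases hk : k = i
      · subst hk; simp
      · simp [hk]
    have h5 := lp.hasSum_single (p := 2) (by norm_num) g
    have h6 := (h5.mapL U₀.toContinuousLinearMap).mapL U₀.toContinuousLinearMap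
    simp only [LinearIsometry.coe_toContinuousLinearMap, h1] at h6
    exact h6.unique h5
  exact ⟨LinearIsometryEquiv.ofSurjective U₀ fun g => ⟨U₀ g, hinv g⟩, hinv, hU₀⟩

open scoped lp in
/-- The block-diagonal matrix whose blocks are the Hankel matrices `s i * h i (k + n)` with
orthonormal rows acts as an isometric involution which is isometric on each block. -/
theorem exists_involution_of_hankel {I : Type*} [DecidableEq I] (s : I → ℝ)
    (hs : ∀ i, s i * s i = 1) (h : I → ℤ → ℝ)
    (hh : ∀ i n m, HasSum (fun k => h i (n + k) * h i (m + k)) (if n = m then 1 else 0)) :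
    ∃ U : ℓ²(I × ℤ, ℂ) ≃ₗᵢ[ℂ] ℓ²(I × ℤ, ℂ), (∀ g, U (U g) = g) ∧
      (∀ g i k, HasSum (fun n => ((s i * h i (k + n) : ℝ) : ℂ) * g (i, n)) (U g (i, k))) ∧
      ∀ g i, ∃ S : ℝ, HasSum (fun n => ‖g (i, n)‖ ^ 2) S ∧
        HasSum (fun n => ‖U g (i, n)‖ ^ 2) S := by
  have hblock (i : I) (n m : ℤ) :
      HasSum (fun k => s i * h i (n + k) * (s i * h i (m + k))) (if n = m then 1 else 0) :=
    (hh i n m).congr_fun fun k => by linear_combination (h i (n + k) * h i (m + k)) * hs i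
  have hinj (i : I) : Function.Injective fun n : ℤ => (i, n) := fun a b hab => by simpa using hab
  have hrange {i : I} {x : I × ℤ} (hx : x ∉ Set.range fun n : ℤ => (i, n)) : i ≠ x.1 :=
    fun hi => hx ⟨x.2, by simp [hi]⟩
  obtain ⟨U, hU, hUs⟩ := exists_involution_of_symmetric_orthonormal
    (fun x y : I × ℤ => if x.1 = y.1 then s x.1 * h x.1 (x.2 + y.2) else 0)
    (fun x y => by
      by_cases hxy : x.1 = y.1
      · simp [hxy, add_comm]
      · simp [hxy, Ne.symm hxy])
    (fun ⟨i, n⟩ ⟨j, m⟩ => by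
      by_cases hij : i = j
      · subst hij
        rw [← (hinj i).hasSum_iff]
        · convert hblock i n m using 1
          · ext k; simp
          · simp
        · intro x hx
          simp [hrange hx]
      · convert hasSum_zero using 1
        · ext x
          by_cases hx : i = x.1
          · simp [← hx, Ne.symm hij]
          · simp [hx]
        · simp [hij])
  have hUb (g : ℓ²(I × ℤ, ℂ)) (i : I) (k : ℤ) :
      HasSum (fun n => ((s i * h i (k + n) : ℝ) : ℂ) * g (i, n)) (U g (i, k)) := by
    have h1 := hUs g (i, k)
    rw [← (hinj i).hasSum_iff] at h1
    · refine h1.congr_fun fun n => ?_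
      simp
    · intro x hx
      simp [hrange hx]
  refine ⟨U, hU, hUb, fun g i => ?_⟩
  obtain ⟨W, -, hW⟩ := exists_involution_of_symmetric_orthonormal
    (fun k n => s i * h i (k + n)) (fun k n => by rw [add_comm]) (hblock i)
  have hg : Memℓp (fun n : ℤ => g (i, n)) 2 := by
    refine memℓp_gen ?_
    have := (lp.hasSum_norm (p := 2) (by norm_num) g).summable
    exact this.comp_injective (hinj i)
  let gi : ℓ²(ℤ, ℂ) := ⟨fun n => g (i, n), hg⟩
  have h1 (k : ℤ) : W gi k = U g (i, k) := (hW gi k).unique (hUb g i k)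
  have h2 := lp.hasSum_norm (p := 2) (by norm_num) gi
  have h3 := lp.hasSum_norm (p := 2) (by norm_num) (W gi)
  rw [W.norm_map] at h3
  simp only [ENNReal.toReal_ofNat, Real.rpow_ofNat] at h2 h3
  exact ⟨_, h2, by simpa only [h1] using h3⟩

/-! ### The lattice measure -/

/-- The mass of the point `σ q^m`. -/
noncomputable def pointMass (q : ℝ) (m : ℤ) : ℝ := (q - q⁻¹) / 2 * q ^ m

section

variable {q : ℝ}

theorem sub_inv_pos (hq : 1 < q) : 0 < q - q⁻¹ := by
  have := inv_lt_one_of_one_lt₀ hq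
  linarith

theorem pointMass_pos (hq : 1 < q) (m : ℤ) : 0 < pointMass q m := by
  have := sub_inv_pos hq
  have : 0 < q := one_pos.trans hq
  unfold pointMass
  positivity

theorem latticePt_inj (hq : 1 < q) {σ τ : ℤˣ} {m n : ℤ} :
    latticePt q σ m = latticePt q τ n ↔ σ = τ ∧ m = n := by
  refine ⟨fun h => ?_, fun h => by rw [h.1, h.2]⟩
  have hq0 : 0 < q := one_pos.trans hq
  have hm : 0 < q ^ m := by positivity
  have hn : 0 < q ^ n := by positivity
  have key : q ^ m = q ^ n → m = n := fun h => zpow_right_injective₀ hq0 hq.ne' h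
  unfold latticePt at h
  rcases Int.units_eq_one_or σ with rfl | rfl <;> rcases Int.units_eq_one_or τ with rfl | rfl
  · exact ⟨rfl, key (by simpa using h)⟩
  · norm_num at h; linarith
  · norm_num at h; linarith
  · exact ⟨rfl, key (by simpa using h)⟩

theorem ae_jackson_iff (hq : 1 < q) {P : ℝ → Prop} :
    (∀ᵐ x ∂jackson q, P x) ↔ ∀ (σ : ℤˣ) (m : ℤ), P (latticePt q σ m) := by
  have h (p : ℤˣ × ℤ) : (∀ᵐ x ∂(ENNReal.ofReal ((q - q⁻¹) / 2 * q ^ (p.2 - 1)) •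
      Measure.dirac (latticePt q p.1 (p.2 - 1))), P x) ↔ P (latticePt q p.1 (p.2 - 1)) := by
    rw [Measure.ae_ennreal_smul_measure_iff, ae_dirac_eq, Filter.eventually_pure]
    exact (ENNReal.ofReal_pos.2 (pointMass_pos hq _)).ne'
  rw [jackson, Measure.ae_sum_iff]
  simp only [h]
  exact ⟨fun H σ m => by simpa using H (σ, m + 1), fun H p => H _ _⟩

theorem jackson_singleton (hq : 1 < q) (σ : ℤˣ) (m : ℤ) :
    jackson q {latticePt q σ m} = ENNReal.ofReal (pointMass q m) := by
  rw [jackson, Measure.sum_apply _ (measurableSet_singleton _), tsum_eq_single (σ, m + 1)]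
  · simp [pointMass]
  · rintro ⟨τ, n⟩ hne
    rw [Measure.smul_apply, Measure.dirac_apply' _ (measurableSet_singleton _),
      Set.indicator_of_notMem, smul_zero]
    rw [Set.mem_singleton_iff, latticePt_inj hq]
    rintro ⟨rfl, h⟩
    exact hne (by rw [← h, sub_add_cancel])

/-- The normalized indicator functions of the lattice points form a Hilbert basis. -/
theorem exists_pointBasis (hq : 1 < q) {J : Type*} (e : J ≃ ℤˣ × ℤ) :
    ∃ b : HilbertBasis J ℂ (L2q q), ∀ (f : L2q q) (j : J),
      b.repr f j = (Real.sqrt (pointMass q (e j).2) : ℂ) * f (latticePt q (e j).1 (e j).2) := by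
  classical
  have hfin (j : J) : jackson q {latticePt q (e j).1 (e j).2} ≠ ⊤ := by
    rw [jackson_singleton hq]; exact ENNReal.ofReal_ne_top
  let χ (j : J) : L2q q := indicatorConstLp 2 (measurableSet_singleton _) (hfin j) (1 : ℂ)
  have hχ (i j : J) : χ j (latticePt q (e i).1 (e i).2) = if i = j then 1 else 0 := by
    have h := (ae_jackson_iff hq).1 (indicatorConstLp_coeFn (p := 2)
      (hs := measurableSet_singleton _) (hμs := hfin j) (c := (1 : ℂ))) (e i).1 (e i).2
    refine h.trans ?_
    by_cases hij : i = j
    · subst hij; simp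
    · rw [Set.indicator_of_notMem, if_neg hij]
      rw [Set.mem_singleton_iff, latticePt_inj hq, ← Prod.ext_iff, e.injective.eq_iff]
      exact hij
  let v (j : J) : L2q q := ((Real.sqrt (pointMass q (e j).2))⁻¹ : ℂ) • χ j
  have hv (f : L2q q) (j : J) : inner ℂ (v j) f =
      (Real.sqrt (pointMass q (e j).2) : ℂ) * f (latticePt q (e j).1 (e j).2) := by
    have hw := pointMass_pos hq (e j).2
    rw [inner_smul_left, L2.inner_indicatorConstLp_one, integral_singleton, Measure.real,
      jackson_singleton hq, ENNReal.toReal_ofReal hw.le, Complex.real_smul, ← mul_assoc,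
      map_inv₀, Complex.conj_ofReal]
    congr 1
    rw [inv_mul_eq_iff_eq_mul₀ (by simpa using (Real.sqrt_pos.2 hw).ne')]
    norm_cast
    exact (Real.mul_self_sqrt hw.le).symm
  have horth : Orthonormal ℂ v := by
    rw [orthonormal_iff_ite]
    intro i j
    have h := (ae_jackson_iff hq).1 (Lp.coeFn_smul ((Real.sqrt (pointMass q (e j).2))⁻¹ : ℂ) (χ j))
      (e i).1 (e i).2
    rw [hv]
    change _ * (((Real.sqrt (pointMass q (e j).2))⁻¹ : ℂ) • χ j : L2q q) _ = _
    rw [h, Pi.smul_apply, hχ]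
    split_ifs with hij
    · subst hij
      have := (Real.sqrt_pos.2 (pointMass_pos hq (e i).2)).ne'
      rw [smul_eq_mul, mul_one, mul_inv_cancel₀ (by exact_mod_cast this)]
    · simp
  have hbot : (Submodule.span ℂ (Set.range v))ᗮ = ⊥ := by
    rw [eq_bot_iff]
    intro f hf
    rw [Submodule.mem_bot, Lp.eq_zero_iff_ae_eq_zero, Filter.EventuallyEq, ae_jackson_iff hq]
    intro σ m
    have h := Submodule.inner_right_of_mem_orthogonal
      (Submodule.subset_span (Set.mem_range_self (f := v) (e.symm (σ, m)))) hf
    rw [hv, e.apply_symm_apply] at h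
    have := (Real.sqrt_pos.2 (pointMass_pos hq m)).ne'
    simpa [this] using h
  let b : HilbertBasis J ℂ (L2q q) := HilbertBasis.mkOfOrthogonalEqBot horth hbot
  have hb : ⇑b = v := HilbertBasis.coe_mkOfOrthogonalEqBot horth hbot
  exact ⟨b, fun f j => by rw [b.repr_apply_apply, hb, hv]⟩

theorem hasSum_inner_L2q (hq : 1 < q) {J : Type*} (e : J ≃ ℤˣ × ℤ) (χ ψ : L2q q) :
    HasSum (fun j => (pointMass q (e j).2 : ℂ) * (conj (χ (latticePt q (e j).1 (e j).2)) *
      ψ (latticePt q (e j).1 (e j).2))) (inner ℂ χ ψ) := by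
  obtain ⟨b, hb⟩ := exists_pointBasis hq e
  have h := lp.hasSum_inner (𝕜 := ℂ) (b.repr χ) (b.repr ψ)
  rw [b.repr.inner_map_map] at h
  refine h.congr_fun fun j => ?_
  have hw : (Real.sqrt (pointMass q (e j).2) : ℂ) * Real.sqrt (pointMass q (e j).2) =
      pointMass q (e j).2 := by
    norm_cast
    exact Real.mul_self_sqrt (pointMass_pos hq _).le
  rw [hb, hb, RCLike.inner_apply, map_mul, Complex.conj_ofReal, ← hw]
  ring

/-! ### The four sectors -/

theorem latticePt_mem_sectorPts (hq : 1 < q) {σ τ : ℤˣ} {ε : Fin 2} {m : ℤ} :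
    latticePt q τ m ∈ sectorPts q σ ε ↔ τ = σ ∧ ∃ k : ℤ, m = 2 * k + ((ε : ℕ) : ℤ) - 1 := by
  simp [sectorPts, latticePt_inj hq]

theorem mem_sector_iff (hq : 1 < q) {σ : ℤˣ} {ε : Fin 2} {ψ : L2q q} :
    ψ ∈ sector q σ ε ↔
      ∀ (τ : ℤˣ) (m : ℤ), latticePt q τ m ∉ sectorPts q σ ε → ψ (latticePt q τ m) = 0 :=
  ae_jackson_iff hq

/-- The labelling of the lattice points by sector and position, `((σ, ε), k) ↦ (σ, 2k + ε + a)`. -/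
noncomputable def sectorEquiv (a : ℤ) : (ℤˣ × Fin 2) × ℤ ≃ ℤˣ × ℤ :=
  Equiv.ofBijective (fun x => (x.1.1, 2 * x.2 + ((x.1.2 : ℕ) : ℤ) + a)) <| by
    constructor
    · rintro ⟨⟨σ, ε⟩, k⟩ ⟨⟨τ, δ⟩, l⟩ h
      simp only [Prod.mk.injEq] at h ⊢
      have h1 := ε.isLt
      have h2 := δ.isLt
      exact ⟨⟨h.1, Fin.ext (by omega)⟩, by omega⟩
    · rintro ⟨σ, m⟩
      refine ⟨((σ, ⟨((m - a) % 2).toNat, by omega⟩), (m - a) / 2), ?_⟩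
      simp only [Prod.mk.injEq, true_and]
      omega

@[simp]
theorem sectorEquiv_apply (a : ℤ) (σ : ℤˣ) (ε : Fin 2) (k : ℤ) :
    sectorEquiv a ((σ, ε), k) = (σ, 2 * k + ((ε : ℕ) : ℤ) + a) := rfl

theorem latticePt_sectorEquiv_mem_sectorPts (hq : 1 < q) (i : ℤˣ × Fin 2)
    (x : (ℤˣ × Fin 2) × ℤ) :
    latticePt q (sectorEquiv (-1) x).1 (sectorEquiv (-1) x).2 ∈ sectorPts q i.1 i.2 ↔
      x.1 = i := by
  rw [latticePt_mem_sectorPts hq]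
  constructor
  · rintro ⟨h1, k, h2⟩
    have h : sectorEquiv (-1) x = sectorEquiv (-1) (i, k) := Prod.ext h1 h2
    exact congrArg Prod.fst ((sectorEquiv (-1)).injective h)
  · rintro rfl
    exact ⟨rfl, x.2, rfl⟩

theorem forall_latticePt_iff {P : ℝ → Prop} (a : ℤ) :
    (∀ (σ : ℤˣ) (m : ℤ), P (latticePt q σ m)) ↔
      ∀ x, P (latticePt q (sectorEquiv a x).1 (sectorEquiv a x).2) := by
  refine ⟨fun H x => H _ _, fun H σ m => ?_⟩
  simpa using H ((sectorEquiv a).symm (σ, m))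

theorem mem_sector_iff' (hq : 1 < q) {i : ℤˣ × Fin 2} {ψ : L2q q} :
    ψ ∈ sector q i.1 i.2 ↔
      ∀ x, x.1 ≠ i → ψ (latticePt q (sectorEquiv (-1) x).1 (sectorEquiv (-1) x).2) = 0 := by
  rw [mem_sector_iff hq,
    forall_latticePt_iff (P := fun y => y ∉ sectorPts q i.1 i.2 → ψ y = 0) (-1)]
  simp only [latticePt_sectorEquiv_mem_sectorPts hq, ne_eq]

theorem sectorProj_sectorEquiv (hq : 1 < q) (i : ℤˣ × Fin 2) (h : ℝ → ℂ)
    (x : (ℤˣ × Fin 2) × ℤ) :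
    sectorProj q i.1 i.2 h (latticePt q (sectorEquiv (-1) x).1 (sectorEquiv (-1) x).2) =
      if x.1 = i then h (latticePt q (sectorEquiv (-1) x).1 (sectorEquiv (-1) x).2) else 0 := by
  classical
  rw [sectorProj, Set.indicator_apply]
  simp only [latticePt_sectorEquiv_mem_sectorPts hq]

theorem ae_jackson_iff' (hq : 1 < q) {P : ℝ → Prop} :
    (∀ᵐ x ∂jackson q, P x) ↔
      ∀ x, P (latticePt q (sectorEquiv (-1) x).1 (sectorEquiv (-1) x).2) := by
  rw [ae_jackson_iff hq, forall_latticePt_iff (-1)]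

theorem orthogonalFamily_sector (hq : 1 < q) :
    OrthogonalFamily ℂ (fun i : ℤˣ × Fin 2 => sector q i.1 i.2)
      (fun i => (sector q i.1 i.2).subtypeₗᵢ) := by
  intro i j hij φ ψ
  have h := hasSum_inner_L2q hq (sectorEquiv (-1)) (φ : L2q q) (ψ : L2q q)
  refine h.unique (hasSum_zero.congr_fun fun x => ?_)
  by_cases hx : x.1 = i
  · rw [(mem_sector_iff' hq).1 ψ.2 x (by rw [hx]; exact hij)]; simp
  · rw [(mem_sector_iff' hq).1 φ.2 x hx]; simp

theorem measurableSet_sectorPts (σ : ℤˣ) (ε : Fin 2) : MeasurableSet (sectorPts q σ ε) := by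
  have : sectorPts q σ ε =
      Set.range fun k : ℤ => latticePt q σ (2 * k + ((ε : ℕ) : ℤ) - 1) := by
    ext x; simp [sectorPts, eq_comm]
  rw [this]
  exact (Set.countable_range _).measurableSet

theorem exists_sectorProj (hq : 1 < q) (i : ℤˣ × Fin 2) (ψ : L2q q) :
    ∃ φ ∈ sector q i.1 i.2, (φ : ℝ → ℂ) =ᵐ[jackson q] sectorProj q i.1 i.2 ψ := by
  have hm : MemLp (sectorProj q i.1 i.2 ψ) 2 (jackson q) :=
    (Lp.memLp ψ).indicator (measurableSet_sectorPts _ _)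
  refine ⟨hm.toLp _, ?_, hm.coeFn_toLp⟩
  rw [mem_sector_iff' hq]
  intro x hx
  rw [(ae_jackson_iff' hq).1 hm.coeFn_toLp x, sectorProj_sectorEquiv hq, if_neg hx]

theorem isInternal_sector (hq : 1 < q) :
    DirectSum.IsInternal (fun i : ℤˣ × Fin 2 => sector q i.1 i.2) := by
  refine DirectSum.isInternal_submodule_of_iSupIndep_of_iSup_eq_top
    (orthogonalFamily_sector hq).independent ?_
  rw [eq_top_iff]
  intro ψ _
  choose φ hφ hφψ using fun i => exists_sectorProj hq i ψ
  have h : ψ = ∑ i, φ i := by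
    refine Lp.ext ?_
    refine (ae_jackson_iff' hq).2 fun x => ?_
    rw [(ae_jackson_iff' hq).1 (Lp.coeFn_finsetSum Finset.univ φ) x, Finset.sum_apply]
    simp [(ae_jackson_iff' hq).1 (hφψ _) x, sectorProj_sectorEquiv hq]
  rw [h]
  exact Submodule.sum_mem _ fun i _ => Submodule.mem_iSup_of_mem i (hφ i)

theorem sub_sectorProj_mem_orthogonal (hq : 1 < q) (i : ℤˣ × Fin 2) {φ ψ : L2q q}
    (h : (φ : ℝ → ℂ) =ᵐ[jackson q] sectorProj q i.1 i.2 ψ) : ψ - φ ∈ (sector q i.1 i.2)ᗮ := by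
  rw [Submodule.mem_orthogonal]
  intro u hu
  refine (hasSum_inner_L2q hq (sectorEquiv (-1)) u (ψ - φ)).unique
    (hasSum_zero.congr_fun fun x => ?_)
  by_cases hx : x.1 = i
  · rw [(ae_jackson_iff' hq).1 (Lp.coeFn_sub ψ φ) x, Pi.sub_apply, (ae_jackson_iff' hq).1 h x,
      sectorProj_sectorEquiv hq, if_pos hx]
    simp
  · rw [(mem_sector_iff' hq).1 hu x hx]; simp

theorem hasSum_norm_sq_of_mem_sector (hq : 1 < q) (σ : ℤˣ) (ε : Fin 2) {ψ : L2q q}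
    (hψ : ψ ∈ sector q σ ε) :
    HasSum (fun k : ℤ => pointMass q (2 * k + ((ε : ℕ) : ℤ) - 1) *
      ‖ψ (latticePt q σ (2 * k + ((ε : ℕ) : ℤ) - 1))‖ ^ 2) (‖ψ‖ ^ 2) := by
  have h := hasSum_inner_L2q hq (sectorEquiv (-1)) ψ ψ
  rw [← (show Function.Injective fun k : ℤ => ((σ, ε), k) from
    fun a b hab => by simpa using hab).hasSum_iff] at h
  · rw [inner_self_eq_norm_sq_to_K] at h
    rw [← Complex.hasSum_ofReal]
    push_cast
    refine h.congr_fun fun k => ?_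
    simp [Complex.conj_mul', ← sub_eq_add_neg]
  · intro x hx
    rw [(mem_sector_iff' hq (i := (σ, ε))).1 hψ x fun h => hx ⟨x.2, by simp [← h]⟩]
    simp

end

/-! ### The orthonormal bases -/

section

variable {q : ℝ}

theorem sqrt_pointMass_ne_zero (hq : 1 < q) (m : ℤ) : (Real.sqrt (pointMass q m) : ℂ) ≠ 0 := by
  exact_mod_cast (Real.sqrt_pos.2 (pointMass_pos hq m)).ne'

/-- The sign in `T(σ x) = ± T(x)`. -/
theorem exists_sign {T : ℝ → ℝ} (hT : T = cosq q ∨ T = sinq q) (σ : ℤˣ) :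
    ∃ s : ℝ, s * s = 1 ∧ ∀ x, T (((σ : ℤ) : ℝ) * x) = s * T x := by
  rcases Int.units_eq_one_or σ with rfl | rfl
  · exact ⟨1, by norm_num, by simp⟩
  · rcases hT with rfl | rfl
    · exact ⟨1, by norm_num, by simp [cosq_neg]⟩
    · exact ⟨-1, by norm_num, by simp [sinq_neg]⟩

/-- The coordinates of `basisFun` with respect to the normalized point functions. -/
theorem sqrt_pointMass_mul_basis (hq : 1 < q) {T : ℝ → ℝ} {σ : ℤˣ} {s : ℝ}
    (hs : ∀ x, T (((σ : ℤ) : ℝ) * x) = s * T x) (ε : Fin 2) (k n : ℤ) :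
    Real.sqrt (pointMass q (2 * k + ((ε : ℕ) : ℤ) - 1)) * (NqTilde q (basisIdx ε n) *
      T (latticePt q σ (2 * k + ((ε : ℕ) : ℤ) - 1) * q ^ basisIdx ε n)) =
        s * hankel q T (k + n) := by
  have hq0 : 0 < q := one_pos.trans hq
  have hd := sub_inv_pos hq
  have e1 : q ^ (2 * k + ((ε : ℕ) : ℤ) - 1) * q ^ basisIdx ε n = q ^ (2 * (k + n)) := by
    rw [← zpow_add₀ hq0.ne', basisIdx]; congr 1; ring
  have e2 : Real.sqrt (pointMass q (2 * k + ((ε : ℕ) : ℤ) - 1)) *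
      Real.sqrt (2 * q ^ basisIdx ε n / (q - q⁻¹)) = q ^ (k + n) := by
    rw [← Real.sqrt_mul (pointMass_pos hq _).le, ← Real.sqrt_sq (by positivity : 0 ≤ q ^ (k + n))]
    congr 1
    rw [pointMass, ← zpow_natCast, ← zpow_mul, mul_comm (k + n), Nat.cast_ofNat, ← e1]
    have hd' := hd.ne'
    generalize q - q⁻¹ = c at hd'
    field_simp
  rw [latticePt, mul_assoc _ (q ^ _), e1, hs, NqTilde, hankel]
  linear_combination (Nq q * (s * T (q ^ (2 * (k + n))))) * e2

/-- In the coordinates of the lattice points the functions `basisFun` are the images of the standard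
unit vectors under the involution with Hankel blocks. -/
theorem exists_hilbertBasis_L2q (hq : 1 < q) (T : ℤˣ → Fin 2 → ℝ → ℝ)
    (hT : ∀ σ ε, T σ ε = cosq q ∨ T σ ε = sinq q) :
    ∃ b : HilbertBasis ((ℤˣ × Fin 2) × ℤ) ℂ (L2q q), ∀ (σ : ℤˣ) (ε : Fin 2) (n : ℤ),
      (b ((σ, ε), n) : ℝ → ℂ) =ᵐ[jackson q] basisFun q (T σ ε) σ ε n := by
  choose s hs1 hs using fun i : ℤˣ × Fin 2 => exists_sign (hT i.1 i.2) i.1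
  obtain ⟨U, hU, hUs, -⟩ := exists_involution_of_hankel s hs1 (fun i => hankel q (T i.1 i.2))
    fun i n m => hasSum_hankel_mul_hankel hq (hT i.1 i.2) n m
  obtain ⟨D, hD⟩ := exists_pointBasis hq (sectorEquiv (-1))
  let b : HilbertBasis ((ℤˣ × Fin 2) × ℤ) ℂ (L2q q) := HilbertBasis.ofRepr (D.repr.trans U)
  refine ⟨b, fun σ ε n => (ae_jackson_iff' hq).2 fun x => ?_⟩
  have hb : D.repr (b ((σ, ε), n)) = U (lp.single 2 ((σ, ε), n) (1 : ℂ)) := by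
    have h : U (D.repr (b ((σ, ε), n))) = lp.single 2 ((σ, ε), n) (1 : ℂ) := b.repr_self _
    rw [← h, hU]
  have h1 := hD (b ((σ, ε), n)) x
  rw [hb] at h1
  refine mul_left_cancel₀ (sqrt_pointMass_ne_zero hq (sectorEquiv (-1) x).2) (h1.symm.trans ?_)
  obtain ⟨i, k⟩ := x
  have h2 := hUs (lp.single 2 ((σ, ε), n) (1 : ℂ)) i k
  have h3 := sectorProj_sectorEquiv hq (σ, ε) (fun x => ((NqTilde q (basisIdx ε n) *
    T σ ε (x * q ^ basisIdx ε n) : ℝ) : ℂ)) (i, k)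
  rw [basisFun]
  refine (h2.unique (hasSum_single n fun m hm => ?_)).trans ?_
  · rw [lp.single_apply_ne _ _ _ (by simp [hm])]
    simp
  · rw [h3]
    by_cases hi : i = (σ, ε)
    · subst hi
      simp only [if_true, sectorEquiv_apply, lp.single_apply_self, mul_one, ← sub_eq_add_neg]
      rw [← Complex.ofReal_mul, sqrt_pointMass_mul_basis hq (hs (σ, ε))]
    · rw [lp.single_apply_ne _ _ _ (by simp [hi])]
      simp [hi]

theorem isClosed_sector (hq : 1 < q) (i : ℤˣ × Fin 2) :
    IsClosed (sector q i.1 i.2 : Set (L2q q)) := by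
  obtain ⟨D, hD⟩ := exists_pointBasis hq (sectorEquiv (-1))
  have h : (sector q i.1 i.2 : Set (L2q q)) =
      ⋂ (x : (ℤˣ × Fin 2) × ℤ) (_ : x.1 ≠ i), {ψ | inner ℂ (D x) ψ = 0} := by
    ext ψ
    simp only [SetLike.mem_coe, mem_sector_iff' hq, Set.mem_iInter, Set.mem_ofPred_eq,
      ← HilbertBasis.repr_apply_apply, hD, mul_eq_zero, sqrt_pointMass_ne_zero hq, false_or]
  rw [h]
  exact isClosed_iInter fun x => isClosed_iInter fun _ =>
    isClosed_eq (continuous_const.inner continuous_id) continuous_const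

theorem exists_hilbertBasis_sector (hq : 1 < q) {T : ℝ → ℝ} (hT : T = cosq q ∨ T = sinq q)
    (σ : ℤˣ) (ε : Fin 2) :
    ∃ b : HilbertBasis ℤ ℂ (sector q σ ε),
      ∀ n : ℤ, ((b n : L2q q) : ℝ → ℂ) =ᵐ[jackson q] basisFun q T σ ε n := by
  obtain ⟨B, hB⟩ := exists_hilbertBasis_L2q hq (fun _ _ => T) fun _ _ => hT
  have hmem (x : (ℤˣ × Fin 2) × ℤ) : B x ∈ sector q x.1.1 x.1.2 := by
    rw [mem_sector_iff' hq]
    intro y hy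
    rw [(ae_jackson_iff' hq).1 (hB x.1.1 x.1.2 x.2) y, basisFun, sectorProj_sectorEquiv hq,
      if_neg hy]
  have : CompleteSpace (sector q σ ε) := (isClosed_sector hq (σ, ε)).completeSpace_coe
  let v (n : ℤ) : sector q σ ε := ⟨B ((σ, ε), n), hmem ((σ, ε), n)⟩
  have horth : Orthonormal ℂ v := by
    have h := B.orthonormal.comp (fun n : ℤ => ((σ, ε), n)) fun a b hab => by simpa using hab
    rw [orthonormal_iff_ite] at h ⊢
    exact h
  -- the basis vectors of the other sectors are orthogonal to this sector
  have hbot : (Submodule.span ℂ (Set.range v))ᗮ = ⊥ := by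
    rw [eq_bot_iff]
    intro ψ hψ
    have h0 : B.repr (ψ : L2q q) = 0 := by
      ext x
      rw [B.repr_apply_apply]
      by_cases hx : x.1 = (σ, ε)
      · obtain ⟨i, n⟩ := x
        obtain rfl : i = (σ, ε) := hx
        have h : inner ℂ (v n) ψ = 0 := Submodule.inner_right_of_mem_orthogonal
          (Submodule.subset_span (Set.mem_range_self n)) hψ
        exact h
      · exact orthogonalFamily_sector hq hx ⟨B x, hmem x⟩ ψ
    rw [Submodule.mem_bot, ← Submodule.coe_eq_zero]
    simpa using h0
  let b : HilbertBasis ℤ ℂ (sector q σ ε) := HilbertBasis.mkOfOrthogonalEqBot horth hbot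
  have hb : ⇑b = v := HilbertBasis.coe_mkOfOrthogonalEqBot horth hbot
  exact ⟨b, fun n => by rw [hb]; exact hB σ ε n⟩

/-! ### The cosine and sine transforms -/

theorem sqrt_pointMass_add_two_mul (hq : 1 < q) (m k : ℤ) :
    Real.sqrt (pointMass q (m + 2 * k)) = q ^ k * Real.sqrt (pointMass q m) := by
  have hq0 : 0 < q := one_pos.trans hq
  rw [← Real.sqrt_sq (by positivity : 0 ≤ q ^ k), ← Real.sqrt_mul (by positivity)]
  congr 1
  rw [pointMass, pointMass, zpow_add₀ hq0.ne', ← zpow_natCast, ← zpow_mul, mul_comm k]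
  push_cast
  ring

/-- The transform is the involution with Hankel blocks in the coordinates `k ↦ σ q^{-2k+ε}`. -/
theorem exists_transform (hq : 1 < q) {T : ℝ → ℝ} (hT : T = cosq q ∨ T = sinq q) :
    ∃ F : L2q q ≃ₗᵢ[ℂ] L2q q, (∀ f : L2q q, F (F f) = f) ∧
      ∀ (f : L2q q) (σ : ℤˣ) (ε : Fin 2),
        (∀ n : ℤ, HasSum (fun k : ℤ =>
            (Nq q : ℂ) * (((q ^ (-2 * k) * T (q ^ (-2 * (k + n))) : ℝ) : ℂ) *
              f (latticePt q σ (-2 * k + ((ε : ℕ) : ℤ)))))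
          (F f (latticePt q σ (-2 * n + ((ε : ℕ) : ℤ))))) ∧
        ∃ S : ℝ,
          HasSum (fun k : ℤ => q ^ (-2 * k + ((ε : ℕ) : ℤ)) *
            ‖f (latticePt q σ (-2 * k + ((ε : ℕ) : ℤ)))‖ ^ 2) S ∧
          HasSum (fun n : ℤ => q ^ (-2 * n + ((ε : ℕ) : ℤ)) *
            ‖F f (latticePt q σ (-2 * n + ((ε : ℕ) : ℤ)))‖ ^ 2) S := by
  have hq0 : 0 < q := one_pos.trans hq
  obtain ⟨U, hU, hUs, hUn⟩ := exists_involution_of_hankel (fun _ : ℤˣ × Fin 2 => (1 : ℝ))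
    (fun _ => one_mul 1) (fun _ n => hankel q T (-n)) fun _ n m => by
      have h := (Equiv.neg ℤ).hasSum_iff.2 (hasSum_hankel_mul_hankel hq hT (-n) (-m))
      simpa [Function.comp_def, add_comm] using h
  obtain ⟨D, hD⟩ := exists_pointBasis hq
    ((Equiv.prodCongr (Equiv.refl (ℤˣ × Fin 2)) (Equiv.neg ℤ)).trans (sectorEquiv 0))
  have hD' (f : L2q q) (σ : ℤˣ) (ε : Fin 2) (k : ℤ) : D.repr f ((σ, ε), k) =
      (Real.sqrt (pointMass q (-2 * k + ((ε : ℕ) : ℤ))) : ℂ) *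
        f (latticePt q σ (-2 * k + ((ε : ℕ) : ℤ))) := by
    rw [hD]
    simp
  let F : L2q q ≃ₗᵢ[ℂ] L2q q := D.repr.trans (U.trans D.repr.symm)
  have hF (f : L2q q) : D.repr (F f) = U (D.repr f) := by simp [F]
  refine ⟨F, fun f => D.repr.injective (by rw [hF, hF, hU]), fun f σ ε => ⟨fun n => ?_, ?_⟩⟩
  · have h := hUs (D.repr f) (σ, ε) n
    rw [← hF, hD'] at h
    have h2 := h.mul_left (Real.sqrt (pointMass q (-2 * n + ((ε : ℕ) : ℤ))) : ℂ)⁻¹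
    rw [inv_mul_cancel_left₀ (sqrt_pointMass_ne_zero hq _)] at h2
    refine h2.congr_fun fun k => ?_
    rw [hD', eq_inv_mul_iff_mul_eq₀ (sqrt_pointMass_ne_zero hq _),
      show -2 * k + ((ε : ℕ) : ℤ) = -2 * n + ((ε : ℕ) : ℤ) + 2 * (n - k) by ring,
      sqrt_pointMass_add_two_mul hq, hankel, show 2 * -(n + k) = -2 * (k + n) by ring]
    have e : q ^ (-(n + k)) * q ^ (n - k) = q ^ (-2 * k) := by
      rw [← zpow_add₀ hq0.ne']; congr 1; ring
    rw [← e]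
    push_cast
    ring
  · obtain ⟨S, h1, h2⟩ := hUn (D.repr f) (σ, ε)
    rw [← hF] at h2
    have hd : (q - q⁻¹) / 2 ≠ 0 := (half_pos (sub_inv_pos hq)).ne'
    have key (g : L2q q) (k : ℤ) : q ^ (-2 * k + ((ε : ℕ) : ℤ)) *
        ‖g (latticePt q σ (-2 * k + ((ε : ℕ) : ℤ)))‖ ^ 2 =
          ((q - q⁻¹) / 2)⁻¹ * ‖D.repr g ((σ, ε), k)‖ ^ 2 := by
      rw [hD', norm_mul, mul_pow, Complex.norm_real, Real.norm_of_nonneg (Real.sqrt_nonneg _),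
        Real.sq_sqrt (pointMass_pos hq _).le, pointMass, eq_inv_mul_iff_mul_eq₀ hd, mul_assoc]
    exact ⟨((q - q⁻¹) / 2)⁻¹ * S, (h1.mul_left _).congr_fun (key f),
      (h2.mul_left _).congr_fun (key (F f))⟩

end

/-! ### The structure of `L²_q` -/

theorem mainTheorem6 (q : ℝ) (hq : 1 < q) :
    -- the scalar product of `L²_q`
    (∀ χ ψ : L2q q,
      HasSum (fun p : ℤˣ × ℤ => (((q - q⁻¹) / 2 : ℝ) : ℂ) * ((p.1 : ℤ) : ℂ) *
          dilate q (fun x : ℝ => (x : ℂ) * (conj (χ x) * ψ x)) (latticePt q p.1 p.2))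
        (inner ℂ χ ψ)) ∧
    -- the four subspaces: orthogonal decomposition, projectors, norms
    OrthogonalFamily ℂ (fun i : ℤˣ × Fin 2 => sector q i.1 i.2)
      (fun i => (sector q i.1 i.2).subtypeₗᵢ) ∧
    DirectSum.IsInternal (fun i : ℤˣ × Fin 2 => sector q i.1 i.2) ∧
    (∀ (σ : ℤˣ) (ε : Fin 2) (ψ : L2q q), ∃ φ ∈ sector q σ ε,
      (φ : ℝ → ℂ) =ᵐ[jackson q] sectorProj q σ ε ψ ∧ ψ - φ ∈ (sector q σ ε)ᗮ) ∧
    (∀ (σ : ℤˣ) (ε : Fin 2), ∀ ψ ∈ sector q σ ε,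
      HasSum (fun k : ℤ => (q - q⁻¹) / 2 * ((σ : ℤ) : ℝ) *
          dilate q (fun x : ℝ => x * ‖ψ x‖ ^ 2) (latticePt q σ (2 * k + ((ε : ℕ) : ℤ))))
        (‖ψ‖ ^ 2)) ∧
    -- the cosines, and likewise the sines, are an orthonormal basis of each subspace
    (∀ T : ℝ → ℝ, (T = cosq q ∨ T = sinq q) → ∀ (σ : ℤˣ) (ε : Fin 2),
      ∃ b : HilbertBasis ℤ ℂ (sector q σ ε),
        ∀ n : ℤ, ((b n : L2q q) : ℝ → ℂ) =ᵐ[jackson q] basisFun q T σ ε n) ∧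
    -- any combination of these bases is an orthonormal basis of `L²_q`
    (∀ T : ℤˣ → Fin 2 → ℝ → ℝ, (∀ σ ε, T σ ε = cosq q ∨ T σ ε = sinq q) →
      ∃ b : HilbertBasis ((ℤˣ × Fin 2) × ℤ) ℂ (L2q q), ∀ (σ : ℤˣ) (ε : Fin 2) (n : ℤ),
        (b ((σ, ε), n) : ℝ → ℂ) =ᵐ[jackson q] basisFun q (T σ ε) σ ε n) ∧
    -- the cosine transform, and likewise the sine transform, is an isometric involution
    (∀ T : ℝ → ℝ, (T = cosq q ∨ T = sinq q) →
      ∃ F : L2q q ≃ₗᵢ[ℂ] L2q q,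
        (∀ f : L2q q, F (F f) = f) ∧
        ∀ (f : L2q q) (σ : ℤˣ) (ε : Fin 2),
          (∀ n : ℤ, HasSum (fun k : ℤ =>
              (Nq q : ℂ) * (((q ^ (-2 * k) * T (q ^ (-2 * (k + n))) : ℝ) : ℂ) *
                f (latticePt q σ (-2 * k + ((ε : ℕ) : ℤ)))))
            (F f (latticePt q σ (-2 * n + ((ε : ℕ) : ℤ))))) ∧
          (∀ k : ℤ, HasSum (fun n : ℤ =>
              (Nq q : ℂ) * (((q ^ (-2 * n) * T (q ^ (-2 * (k + n))) : ℝ) : ℂ) *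
                F f (latticePt q σ (-2 * n + ((ε : ℕ) : ℤ)))))
            (f (latticePt q σ (-2 * k + ((ε : ℕ) : ℤ))))) ∧
          ∃ S : ℝ,
            HasSum (fun k : ℤ => q ^ (-2 * k + ((ε : ℕ) : ℤ)) *
              ‖f (latticePt q σ (-2 * k + ((ε : ℕ) : ℤ)))‖ ^ 2) S ∧
            HasSum (fun n : ℤ => q ^ (-2 * n + ((ε : ℕ) : ℤ)) *
              ‖F f (latticePt q σ (-2 * n + ((ε : ℕ) : ℤ)))‖ ^ 2) S) := by
  have hq0 : 0 < q := one_pos.trans hq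
  have hdil {E : Type} (h : ℝ → E) (σ : ℤˣ) (m : ℤ) :
      dilate q h (latticePt q σ m) = h (latticePt q σ (m - 1)) := by
    rw [dilate, latticePt, latticePt, mul_left_comm, zpow_sub_one₀ hq0.ne', mul_comm (q⁻¹)]
  have hσ (σ : ℤˣ) : ((σ : ℤ) : ℝ) * ((σ : ℤ) : ℝ) = 1 := by
    rcases Int.units_eq_one_or σ with rfl | rfl <;> norm_num
  have hmass (σ : ℤˣ) (m : ℤ) :
      (q - q⁻¹) / 2 * ((σ : ℤ) : ℝ) * latticePt q σ m = pointMass q m := by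
    rw [latticePt, pointMass]
    linear_combination ((q - q⁻¹) / 2 * q ^ m) * hσ σ
  refine ⟨fun χ ψ => ?_, orthogonalFamily_sector hq, isInternal_sector hq, fun σ ε ψ => ?_,
    fun σ ε ψ hψ => ?_, fun T hT σ ε => exists_hilbertBasis_sector hq hT σ ε,
    fun T hT => exists_hilbertBasis_L2q hq T hT, fun T hT => ?_⟩
  · refine (hasSum_inner_L2q hq (Equiv.prodCongr (Equiv.refl ℤˣ) (Equiv.subRight 1)) χ ψ).congr_fun
      fun p => ?_
    rw [hdil]
    simp only [Equiv.prodCongr_apply, Prod.map, Equiv.refl_apply, Equiv.subRight_apply]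
    rw [← hmass p.1 (p.2 - 1)]
    push_cast
    ring
  · obtain ⟨φ, h1, h2⟩ := exists_sectorProj hq (σ, ε) ψ
    exact ⟨φ, h1, h2, sub_sectorProj_mem_orthogonal hq (σ, ε) h2⟩
  · refine (hasSum_norm_sq_of_mem_sector hq σ ε hψ).congr_fun fun k => ?_
    rw [hdil, ← hmass σ]
    ring
  · obtain ⟨F, hF, h⟩ := exists_transform hq hT
    refine ⟨F, hF, fun f σ ε => ⟨(h f σ ε).1, fun k => ?_, (h f σ ε).2⟩⟩
    have h2 := (h (F f) σ ε).1 k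
    rw [hF] at h2
    refine h2.congr_fun fun n => ?_
    rw [add_comm k n]
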